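/- Let $a<a_1<b_1<b$, $\Omega=(a,b)$, $\Omega_1=(a_1,b_1)$, $\Omega_2=(a,a_1)\cup(b_1,b)$. Let $\alpha,\beta,\gamma>0$ and $\kappa\ge 0$ be constants, $h,q\in L^2(\Omega)$ and $g\in H^1(\Omega)$. Let $r$ be the signed distance to $\partial\Omega_1=\{a_1,b_1\}$, positive in $\Omega_1$ and negative outside $\overline{\Omega_1}$, and for $\varepsilon\in(0,1)$ put $$\phi_\varepsilon=\tfrac12\bigl[1+\tanh(r/\varepsilon)\bigr],\quad D_\varepsilon=\alpha+(1-\alpha)\phi_\varepsilon,\quad c_\varepsilon=\beta+(\gamma-\beta)\phi_\varepsilon,\quad f_\varepsilon=h+(q-h)\phi_\varepsilon,$$ $$D_0=\chi_{\Omega_1}+\alpha\chi_{\Omega_2},\quad c_0=\gamma\chi_{\Omega_1}+\beta\chi_{\Omega_2},\quad f_0=q\chi_{\Omega_1}+h\chi_{\Omega_2}.$$ Define $\mathcal F_\varepsilon,\mathcal F_0:L^2(\Omega)\to\mathbb R\cup\{+\infty\}$ by $\mathcal F_\varepsilon[u]=\mathcal F_0[u]=+\infty$ for $u\in L^2(\Omega)\setminus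 H^1(\Omega)$ and, for $u\in H^1(\Omega)$, $$\mathcal F_\varepsilon[u]=\int_\Omega\Bigl[\tfrac12\bigl(D_\varepsilon|u'|^2+c_\varepsilon u^2\bigr)-f_\varepsilon u+\bigl(\tfrac12\kappa u^2+gu\bigr)|\phi_\varepsilon'|\Bigr]dx,$$ $$\mathcal F_0[u]=\int_\Omega\Bigl[\tfrac12\bigl(D_0|u'|^2+c_0u^2\bigr)-f_0u\Bigr]dx+\sum_{x\in\{a_1,b_1\}}\bigl(\tfrac12\kappa u(x)^2+g(x)u(x)\bigr),$$ where the point values are those of the continuous representatives of $u$ and $g$. Let $(\varepsilon_k)\subset(0,1)$ be any sequence with $\varepsilon_k\to0$. Then: 1. (Compactness) If $u_k\in L^2(\Omega)$ and $\mathcal F_{\varepsilon_k}[u_k]<M$ for all $k$, with $M<\infty$ independent of $k$, then there are a subsequence $(u_{k_j})$ and $u\in H^1(\Omega)$ such that $u_{k_j}\to u$ strongly in $L^2(\Omega)$, weakly in $H^1(\Omega)$, and almost everywhere in $\Omega$. 2. ($\Gamma$-convergence of $\mathcal F_\varepsilon$ to $\mathcal F_0$ in the strong $L^2(\Omega)$-topology)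 For all $u\in L^2(\Omega)$ and all $u_k\to u$ in $L^2(\Omega)$, $\liminf_{k\to\infty}\mathcal F_{\varepsilon_k}[u_k]\ge\mathcal F_0[u]$; and for every $u\in L^2(\Omega)$ there is a sequence $u_k\to u$ in $L^2(\Omega)$ with $\limsup_{k\to\infty}\mathcal F_{\varepsilon_k}[u_k]\le\mathcal F_0[u]$. -/

import Mathlib

open Set Filter Topology MeasureTheory
open scoped ContDiff

noncomputable section

namespace DiffuseDomain

/-- The Lebesgue space `L²(a, b)`. -/
abbrev L2 (a b : ℝ) : Type := Lp ℝ 2 (volume.restrict (Ioo a b))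

/-- Test functions: smooth functions with compact support contained in `(a, b)`. -/
def IsTestFunction (a b : ℝ) (ψ : ℝ → ℝ) : Prop :=
  ContDiff ℝ ∞ ψ ∧ HasCompactSupport ψ ∧ tsupport ψ ⊆ Ioo a b

/-- `v` is the weak (distributional) derivative of `u` on `(a, b)`. -/
def IsWeakDeriv (a b : ℝ) (u v : ℝ → ℝ) : Prop :=
  ∀ ψ : ℝ → ℝ, IsTestFunction a b ψ →
    ∫ x in Ioo a b, u x * deriv ψ x = - ∫ x in Ioo a b, v x * ψ x

theorem integrable_mul_of_hasCompactSupport {a b : ℝ} (u : L2 a b) {ψ : ℝ → ℝ}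
    (hc : Continuous ψ) (hs : HasCompactSupport ψ) :
    Integrable (fun x => u x * ψ x) (volume.restrict (Ioo a b)) :=
  (Lp.memLp u).integrable_mul (q := 2) (hc.memLp_of_hasCompactSupport hs)

theorem IsTestFunction.integrable_mul {a b : ℝ} (u : L2 a b) {ψ : ℝ → ℝ}
    (hψ : IsTestFunction a b ψ) :
    Integrable (fun x => u x * ψ x) (volume.restrict (Ioo a b)) :=
  integrable_mul_of_hasCompactSupport u hψ.1.continuous hψ.2.1

theorem IsTestFunction.integrable_mul_deriv {a b : ℝ} (u : L2 a b) {ψ : ℝ → ℝ}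
    (hψ : IsTestFunction a b ψ) :
    Integrable (fun x => u x * deriv ψ x) (volume.restrict (Ioo a b)) :=
  integrable_mul_of_hasCompactSupport u (hψ.1.continuous_deriv (by simp)) hψ.2.1.deriv

/-- The Sobolev space `H¹(a, b)`, as the subspace of `L² × L²` of all pairs `(u, u')` where
`u'` is the weak derivative of `u`. Its norm, inherited from the `ℓ²` product, is
`(‖u‖² + ‖u'‖²)^(1/2)`. -/
def sobolevH1 (a b : ℝ) : Submodule ℝ (WithLp 2 (L2 a b × L2 a b)) where
  carrier := {w | IsWeakDeriv a b w.fst w.snd}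
  zero_mem' := by
    intro ψ _
    have h0 : ((0 : L2 a b) : ℝ → ℝ) =ᵐ[volume.restrict (Ioo a b)] 0 := Lp.coeFn_zero _ _ _
    have e1 : ∫ x in Ioo a b, (0 : L2 a b) x * deriv ψ x = 0 :=
      integral_eq_zero_of_ae (h0.mono fun x hx => by
        simp only [hx, Pi.zero_apply, zero_mul])
    have e2 : ∫ x in Ioo a b, (0 : L2 a b) x * ψ x = 0 :=
      integral_eq_zero_of_ae (h0.mono fun x hx => by
        simp only [hx, Pi.zero_apply, zero_mul])
    change ∫ x in Ioo a b, (0 : L2 a b) x * deriv ψ x =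
      - ∫ x in Ioo a b, (0 : L2 a b) x * ψ x
    rw [e1, e2, neg_zero]
  add_mem' := by
    intro w z hw hz ψ hψ
    have e1 : ∫ x in Ioo a b, (w.fst + z.fst) x * deriv ψ x =
        ∫ x in Ioo a b, (w.fst x * deriv ψ x + z.fst x * deriv ψ x) :=
      integral_congr_ae ((Lp.coeFn_add w.fst z.fst).mono fun x hx => by
        simp only [hx, Pi.add_apply, add_mul])
    have e2 : ∫ x in Ioo a b, (w.snd + z.snd) x * ψ x =
        ∫ x in Ioo a b, (w.snd x * ψ x + z.snd x * ψ x) :=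
      integral_congr_ae ((Lp.coeFn_add w.snd z.snd).mono fun x hx => by
        simp only [hx, Pi.add_apply, add_mul])
    change ∫ x in Ioo a b, (w.fst + z.fst) x * deriv ψ x =
      - ∫ x in Ioo a b, (w.snd + z.snd) x * ψ x
    rw [e1, e2, integral_add (hψ.integrable_mul_deriv _) (hψ.integrable_mul_deriv _),
      integral_add (hψ.integrable_mul _) (hψ.integrable_mul _), hw ψ hψ, hz ψ hψ]
    ring
  smul_mem' := by
    intro c w hw ψ hψ
    have e1 : ∫ x in Ioo a b, (c • w.fst) x * deriv ψ x =
        ∫ x in Ioo a b, c * (w.fst x * deriv ψ x) :=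
      integral_congr_ae ((Lp.coeFn_smul c w.fst).mono fun x hx => by
        simp only [hx, Pi.smul_apply, smul_eq_mul, mul_assoc])
    have e2 : ∫ x in Ioo a b, (c • w.snd) x * ψ x =
        ∫ x in Ioo a b, c * (w.snd x * ψ x) :=
      integral_congr_ae ((Lp.coeFn_smul c w.snd).mono fun x hx => by
        simp only [hx, Pi.smul_apply, smul_eq_mul, mul_assoc])
    change ∫ x in Ioo a b, (c • w.fst) x * deriv ψ x = - ∫ x in Ioo a b, (c • w.snd) x * ψ x
    rw [e1, e2, integral_const_mul, integral_const_mul, hw ψ hψ]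
    ring

/-- The type of elements of `H¹(a, b)`, a normed space. -/
abbrev H1 (a b : ℝ) : Type := sobolevH1 a b

/-- The `L²` function underlying an element of `H¹(a, b)`. -/
def H1.toL2 {a b : ℝ} (w : H1 a b) : L2 a b := w.1.fst

/-- The weak derivative of an element of `H¹(a, b)`. -/
def H1.grad {a b : ℝ} (w : H1 a b) : L2 a b := w.1.snd

open Classical in
/-- The pointwise value at an interior point of an `L²` class that has a continuous
representative on `(a, b)` (as every element of `H¹(a, b)` has); two such representatives
agree on `(a, b)`. -/
def pointValue {a b : ℝ} (u : L2 a b) (x : ℝ) : ℝ :=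
  if h : ∃ f : ℝ → ℝ, ContinuousOn f (Ioo a b) ∧ u =ᵐ[volume.restrict (Ioo a b)] f
  then h.choose x else 0

open Classical in
/-- The signed distance to the boundary of `(a₁, b₁)`, positive inside the interval. -/
def signedDistance (a₁ b₁ x : ℝ) : ℝ :=
  if x ∈ Ioo a₁ b₁ then Metric.infDist x (frontier (Ioo a₁ b₁))
  else - Metric.infDist x (frontier (Ioo a₁ b₁))

/-- The phase-field function `φ_ε`. -/
def phaseField (a₁ b₁ ε x : ℝ) : ℝ :=
  1 / 2 * (1 + Real.tanh (signedDistance a₁ b₁ x / ε))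

/-- The diffuse coefficient `s + (t - s) φ_ε`. -/
def diffuse (a₁ b₁ ε : ℝ) (s t : ℝ → ℝ) (x : ℝ) : ℝ :=
  s x + (t x - s x) * phaseField a₁ b₁ ε x

/-- The sharp coefficient `t χ_{Ω₁} + s χ_{Ω₂}`, where `Ω₁ = (a₁, b₁)` and
`Ω₂ = (a, a₁) ∪ (b₁, b)`. -/
def sharp (a a₁ b₁ b : ℝ) (s t : ℝ → ℝ) (x : ℝ) : ℝ :=
  (Ioo a₁ b₁).indicator t x + (Ioo a a₁ ∪ Ioo b₁ b).indicator s x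

/-- The diffuse energy `E_ε` on `H¹(a, b)`:
`∫ ½ (D_ε |u'|² + c_ε u²) - f_ε u + (½ κ u² + g u) |φ_ε'|`. -/
def diffuseEnergy {a b : ℝ} (a₁ b₁ α β γ κ : ℝ) (h q : L2 a b) (g : H1 a b) (ε : ℝ)
    (u : H1 a b) : ℝ :=
  ∫ x in Ioo a b,
    (1 / 2 * (diffuse a₁ b₁ ε (fun _ => α) (fun _ => 1) x * u.grad x ^ 2
        + diffuse a₁ b₁ ε (fun _ => β) (fun _ => γ) x * u.toL2 x ^ 2)
      - diffuse a₁ b₁ ε h q x * u.toL2 x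
      + (1 / 2 * κ * u.toL2 x ^ 2 + g.toL2 x * u.toL2 x) * |deriv (phaseField a₁ b₁ ε) x|)

/-- The sharp energy `E_0` on `H¹(a, b)`. The boundary integral over `∂Ω₁ = {a₁, b₁}` is the sum
of the point values of the integrand at the two endpoints. -/
def sharpEnergy {a b : ℝ} (a₁ b₁ α β γ κ : ℝ) (h q : L2 a b) (g : H1 a b)
    (u : H1 a b) : ℝ :=
  (∫ x in Ioo a b,
    (1 / 2 * (sharp a a₁ b₁ b (fun _ => α) (fun _ => 1) x * u.grad x ^ 2
        + sharp a a₁ b₁ b (fun _ => β) (fun _ => γ) x * u.toL2 x ^ 2)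
      - sharp a a₁ b₁ b h q x * u.toL2 x))
  + (1 / 2 * κ * pointValue u.toL2 a₁ ^ 2 + pointValue g.toL2 a₁ * pointValue u.toL2 a₁)
  + (1 / 2 * κ * pointValue u.toL2 b₁ ^ 2 + pointValue g.toL2 b₁ * pointValue u.toL2 b₁)

open Classical in
/-- The extension by `+∞` to `L²(a, b)` of a functional on `H¹(a, b)`. (The element of `H¹` over
a given `L²` function is unique, as weak derivatives are.) -/
def extendTop {a b : ℝ} (E : H1 a b → ℝ) (u : L2 a b) : EReal :=
  if h : ∃ w : H1 a b, w.toL2 = u then (E h.choose : EReal) else ⊤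

/-- Sequential Γ-convergence of `F ε`, `ε ∈ (0, 1)`, to `F₀` as `ε → 0`: along every sequence
`ε_k → 0`, the liminf inequality holds and recovery sequences exist. -/
def GammaConverges {X : Type*} [TopologicalSpace X] (F : ℝ → X → EReal) (F₀ : X → EReal) : Prop :=
  ∀ ε : ℕ → ℝ, (∀ k, ε k ∈ Ioo (0 : ℝ) 1) → Tendsto ε atTop (𝓝 0) →
    (∀ (u : X) (U : ℕ → X), Tendsto U atTop (𝓝 u) →
      F₀ u ≤ liminf (fun k => F (ε k) (U k)) atTop) ∧
    (∀ u : X, ∃ U : ℕ → X, Tendsto U atTop (𝓝 u) ∧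
      limsup (fun k => F (ε k) (U k)) atTop ≤ F₀ u)

/-- Compactness: along every sequence `ε_k → 0`, a sequence of bounded energy has a subsequence
that lies in `H¹` and converges to some `w ∈ H¹`, strongly in `L²`, weakly in `H¹` and
almost everywhere. -/
def EnergyCompact {a b : ℝ} (F : ℝ → L2 a b → EReal) : Prop :=
  ∀ ε : ℕ → ℝ, (∀ k, ε k ∈ Ioo (0 : ℝ) 1) → Tendsto ε atTop (𝓝 0) →
    ∀ (U : ℕ → L2 a b) (M : ℝ), (∀ k, F (ε k) (U k) < (M : EReal)) →
      ∃ (σ : ℕ → ℕ) (W : ℕ → H1 a b) (w : H1 a b),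
        StrictMono σ ∧ (∀ j, (W j).toL2 = U (σ j)) ∧
        Tendsto (fun j => U (σ j)) atTop (𝓝 w.toL2) ∧
        (∀ l : H1 a b →L[ℝ] ℝ, Tendsto (fun j => l (W j)) atTop (𝓝 (l w))) ∧
        (∀ᵐ x ∂(volume.restrict (Ioo a b)),
          Tendsto (fun j => U (σ j) x) atTop (𝓝 (w.toL2 x)))

end DiffuseDomain

end

noncomputable section

namespace DiffuseDomain

variable {a a₁ b₁ b α β γ κ ε : ℝ}

/-! ### `L²` and weak derivatives on an interval -/

/-! In one dimension `H¹` embeds into bounded, `1/2`-Hölder functions. Hence a norm-bounded, weakly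
convergent sequence in `H¹` is uniformly bounded and converges at every interior point, even along
moving points; dominated convergence then gives strong `L²` convergence.

Coercivity is uniform in `ε`. The coefficients `D_ε`, `c_ε` are convex combinations of positive
constants, `κ ≥ 0` lets the quadratic surface term be dropped, and `|φ_ε'|` has mass at most `2`, so
the loads grow only linearly in `‖u‖` (`exists_le_diffuseEnergy`). Bounded energy therefore bounds
the `H¹` norm, and weak compactness of balls in a separable Hilbert space gives part 1.

For part 2, every term without a gradient converges along such sequences. The surface term does
because `|φ_ε'|` is a rescaled `½ sech²` kernel of unit mass near each of `a₁`, `b₁`, tested against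
continuously convergent functions (`tendsto_boundaryTerm`). The gradient term is only lower
semicontinuous, so `|u'|²` is replaced by its tangent `2u'w' - |w'|²` at the limit `w`. This is
affine in `u'`, and `D_ε w'` converges strongly in `L²`, so it passes to the limit
(`tendsto_tangentEnergy`). Since the tangent lies below the square, this gives the liminf
inequality. For the constant sequence `w` the tangent is exact, so the same limit gives the recovery
sequence. -/

theorem L2.norm_sq_eq_integral (f : L2 a b) : ‖f‖ ^ 2 = ∫ x in Ioo a b, f x ^ 2 := by
  rw [← real_inner_self_eq_norm_sq, MeasureTheory.L2.inner_def]
  exact integral_congr_ae (ae_of_all _ fun x => by simp [sq])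

theorem L2.integrable_sq (f : L2 a b) :
    Integrable (fun x => f x ^ 2) (volume.restrict (Ioo a b)) :=
  (Lp.memLp f).integrable_sq

theorem L2.integrable (f : L2 a b) : Integrable f (volume.restrict (Ioo a b)) :=
  (Lp.memLp f).integrable one_le_two

theorem L2.integrable_mul (f g : L2 a b) :
    Integrable (fun x => f x * g x) (volume.restrict (Ioo a b)) :=
  (Lp.memLp f).integrable_mul (q := 2) (Lp.memLp g)

theorem L2.inner_eq_integral (f g : L2 a b) : inner ℝ f g = ∫ x in Ioo a b, f x * g x := by
  rw [MeasureTheory.L2.inner_def]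
  exact integral_congr_ae (ae_of_all _ fun x => by simp [mul_comm])

/-- Dominated convergence in `L²`. -/
theorem L2.tendsto_of_dominated {f : ℕ → L2 a b} {f₀ : L2 a b} {G : ℝ → ℝ}
    (hG : MemLp G 2 (volume.restrict (Ioo a b)))
    (hbd : ∀ k, ∀ᵐ x ∂(volume.restrict (Ioo a b)), |f k x| ≤ G x)
    (hlim : ∀ᵐ x ∂(volume.restrict (Ioo a b)), Tendsto (fun k => f k x) atTop (𝓝 (f₀ x))) :
    Tendsto f atTop (𝓝 f₀) := by
  have hbd₀ : ∀ᵐ x ∂(volume.restrict (Ioo a b)), |f₀ x| ≤ G x := by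
    filter_upwards [ae_all_iff.2 hbd, hlim] with x h1 h2
    exact le_of_tendsto h2.abs (Eventually.of_forall h1)
  have key : Tendsto (fun k => ∫ x in Ioo a b, (f k - f₀) x ^ 2) atTop
      (𝓝 (∫ x in Ioo a b, (0 : ℝ))) := by
    -- If `|s|, |t| ≤ G`, then `(s - t)² ≤ 4 G²`.
    refine tendsto_integral_of_dominated_convergence (fun x => 4 * G x ^ 2)
      (fun k => (L2.integrable_sq _).aestronglyMeasurable) (hG.integrable_sq.const_mul 4) ?_ ?_
    · intro k
      filter_upwards [hbd k, hbd₀, Lp.coeFn_sub (f k) f₀] with x h1 h2 h3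
      rw [h3, Pi.sub_apply, Real.norm_eq_abs, abs_of_nonneg (sq_nonneg _)]
      rw [abs_le] at h1 h2
      nlinarith [h1.1, h1.2, h2.1, h2.2]
    · filter_upwards [hlim, ae_all_iff.2 fun k => Lp.coeFn_sub (f k) f₀] with x h1 h2
      simp only [h2, Pi.sub_apply]
      simpa using (h1.sub_const (f₀ x)).pow 2
  rw [tendsto_iff_norm_sub_tendsto_zero]
  have h2 := key.sqrt
  simp only [integral_zero, Real.sqrt_zero, ← L2.norm_sq_eq_integral,
    Real.sqrt_sq (norm_nonneg _)] at h2
  exact h2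

theorem L2.intervalIntegrable (v : L2 a b) {x y : ℝ} (hx : x ∈ Icc a b) (hy : y ∈ Icc a b) :
    IntervalIntegrable v volume x y := by
  have h : IntegrableOn v (Icc a b) := (integrableOn_Icc_iff_integrableOn_Ioo).2 v.integrable
  exact (h.mono_set (uIcc_subset_Icc hx hy)).intervalIntegrable

/-- Cauchy–Schwarz against the indicator of the interval between `x` and `y`, whose `L²` norm is
`√|y - x|`. -/
theorem L2.abs_intervalIntegral_le (v : L2 a b) {x y : ℝ} (hx : x ∈ Icc a b) (hy : y ∈ Icc a b) :
    |∫ t in x..y, v t| ≤ √|y - x| * ‖v‖ := by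
  wlog hxy : x ≤ y generalizing x y
  · rw [intervalIntegral.integral_symm, abs_neg, abs_sub_comm]
    exact this hy hx (le_of_not_ge hxy)
  have hsub : Ioo x y ⊆ Ioo a b := Ioo_subset_Ioo hx.1 hy.2
  have hm : (volume.restrict (Ioo a b)) (Ioo x y) = ENNReal.ofReal (y - x) := by
    rw [Measure.restrict_apply measurableSet_Ioo, inter_eq_left.2 hsub, Real.volume_Ioo]
  have hfin : (volume.restrict (Ioo a b)) (Ioo x y) ≠ ⊤ := by simp [hm]
  have h1 := MeasureTheory.L2.inner_indicatorConstLp_one (𝕜 := ℝ) measurableSet_Ioo hfin v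
  have h2 : ∫ t in x..y, v t = ∫ t in Ioo x y, v t ∂(volume.restrict (Ioo a b)) := by
    rw [intervalIntegral.integral_of_le hxy, integral_Ioc_eq_integral_Ioo,
      Measure.restrict_restrict measurableSet_Ioo, inter_eq_left.2 hsub]
  rw [h2, ← h1, ← Real.norm_eq_abs]
  refine (norm_inner_le_norm _ _).trans (le_of_eq ?_)
  congr 1
  rw [norm_indicatorConstLp (by simp) (by simp), measureReal_def, hm,
    ENNReal.toReal_ofReal (sub_nonneg.2 hxy), abs_of_nonneg (sub_nonneg.2 hxy), Real.sqrt_eq_rpow]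
  simp

theorem IsTestFunction.eq_zero {ψ : ℝ → ℝ} (hψ : IsTestFunction a b ψ) {x : ℝ}
    (hx : x ∉ Ioo a b) : ψ x = 0 :=
  image_eq_zero_of_notMem_tsupport fun h => hx (hψ.2.2 h)

/-- The fundamental lemma of the calculus of variations on `(a, b)`. -/
theorem ae_eq_zero_of_forall_isTestFunction {f : ℝ → ℝ}
    (hf : Integrable f (volume.restrict (Ioo a b)))
    (h : ∀ ψ, IsTestFunction a b ψ → ∫ x in Ioo a b, f x * ψ x = 0) :
    f =ᵐ[volume.restrict (Ioo a b)] 0 := by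
  have hfo : IntegrableOn f (Ioo a b) := hf
  have := isOpen_Ioo.ae_eq_zero_of_integral_contDiff_smul_eq_zero (μ := volume)
    hfo.locallyIntegrableOn (fun ψ h1 h2 h3 => by
      rw [← h ψ ⟨h1, h2, h3⟩]
      symm
      refine (setIntegral_eq_integral_of_forall_compl_eq_zero fun x hx => ?_).trans ?_
      · rw [IsTestFunction.eq_zero ⟨h1, h2, h3⟩ hx, mul_zero]
      · simp only [smul_eq_mul, mul_comm])
  exact (ae_restrict_iff' measurableSet_Ioo).2 this

theorem H1.isWeakDeriv (w : H1 a b) : IsWeakDeriv a b w.toL2 w.grad := w.2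

/-- Weak derivatives are unique by the fundamental lemma. This makes the choice inside `extendTop`
harmless. -/
theorem H1.toL2_injective : Function.Injective (H1.toL2 : H1 a b → L2 a b) := by
  intro w z hwz
  have hg : w.grad = z.grad := by
    have h0 : (fun x => w.grad x - z.grad x) =ᵐ[volume.restrict (Ioo a b)] 0 := by
      refine ae_eq_zero_of_forall_isTestFunction (w.grad.integrable.sub z.grad.integrable) ?_
      intro ψ hψ
      simp only [sub_mul]
      rw [integral_sub (hψ.integrable_mul _) (hψ.integrable_mul _)]
      have h1 := w.isWeakDeriv ψ hψ
      have h2 := z.isWeakDeriv ψ hψ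
      rw [hwz] at h1
      linarith
    exact Lp.ext (h0.mono fun x hx => sub_eq_zero.1 hx)
  apply Subtype.ext
  apply WithLp.ofLp_injective
  exact Prod.ext hwz hg

theorem extendTop_toL2 (E : H1 a b → ℝ) (w : H1 a b) : extendTop E w.toL2 = (E w : EReal) := by
  have h : ∃ z : H1 a b, z.toL2 = w.toL2 := ⟨w, rfl⟩
  rw [extendTop, dif_pos h, H1.toL2_injective h.choose_spec]

theorem exists_toL2_eq_of_extendTop_lt_top {E : H1 a b → ℝ} {u : L2 a b}
    (h : extendTop E u < ⊤) : ∃ w : H1 a b, w.toL2 = u := by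
  by_contra hne
  rw [extendTop, dif_neg hne] at h
  exact lt_irrefl _ h

/-- A smooth compactly supported function of zero mean is the derivative of a test function. -/
theorem IsTestFunction.exists_primitive {η : ℝ → ℝ} (hab : a < b) (hη : IsTestFunction a b η)
    (h0 : ∫ x in Ioo a b, η x = 0) : ∃ ψ, IsTestFunction a b ψ ∧ deriv ψ = η := by
  have hcont := hη.1.continuous
  have hd : ∀ x, HasDerivAt (fun x => ∫ t in a..x, η t) (η x) x := fun x =>
    intervalIntegral.integral_hasDerivAt_right (hcont.intervalIntegrable _ _)
      hcont.aestronglyMeasurable.stronglyMeasurableAtFilter hcont.continuousAt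
  have hderiv : deriv (fun x => ∫ t in a..x, η t) = η := funext fun x => (hd x).deriv
  obtain ⟨a', b', hab', hsub, ha', hb'⟩ : ∃ a' b', a' ≤ b' ∧ tsupport η ⊆ Icc a' b' ∧
      a < a' ∧ b' < b := by
    rcases (tsupport η).eq_empty_or_nonempty with he | hne
    · exact ⟨(a + b) / 2, (a + b) / 2, le_rfl, by simp [he], by linarith, by linarith⟩
    · have hc : IsCompact (tsupport η) := hη.2.1
      obtain ⟨s, hs⟩ := hc.exists_isLeast hne
      obtain ⟨t, ht⟩ := hc.exists_isGreatest hne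
      exact ⟨s, t, hs.2 ht.1, fun x hx => ⟨hs.2 hx, ht.2 hx⟩, (hη.2.2 hs.1).1, (hη.2.2 ht.1).2⟩
  have hz : ∀ x, x ∉ Icc a' b' → η x = 0 := fun x hx =>
    image_eq_zero_of_notMem_tsupport fun h => hx (hsub h)
  have htot : ∫ t in a..b, η t = 0 := by
    rw [intervalIntegral.integral_of_le hab.le, integral_Ioc_eq_integral_Ioo, h0]
  -- Left of `a'` the primitive integrates zero; right of `b'` it equals the total integral of `η`,
  -- which vanishes by the zero-mean assumption.
  have hsupp : tsupport (fun x => ∫ t in a..x, η t) ⊆ Icc a' b' := by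
    refine closure_minimal (fun x hx => ?_) isClosed_Icc
    by_contra hxn
    apply hx
    rcases lt_or_ge x a' with h | h
    · refine intervalIntegral.integral_zero_ae (ae_of_all _ fun t ht => hz t fun h' => ?_)
      have : t ≤ max a x := ht.2
      exact absurd h'.1 (not_le.2 (this.trans_lt (max_lt ha' h)))
    · have hb'x : b' < x := not_le.1 fun h' => hxn ⟨h, h'⟩
      change ∫ t in a..x, η t = 0
      rw [← intervalIntegral.integral_add_adjacent_intervals (hcont.intervalIntegrable a b)
        (hcont.intervalIntegrable b x), htot, zero_add]
      refine intervalIntegral.integral_zero_ae (ae_of_all _ fun t ht => hz t fun h' => ?_)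
      have : min b x < t := ht.1
      exact absurd h'.2 (not_le.2 ((lt_min hb' hb'x).trans this))
  refine ⟨fun x => ∫ t in a..x, η t, ⟨?_, ?_, ?_⟩, hderiv⟩
  · rw [contDiff_infty_iff_deriv, hderiv]
    exact ⟨fun x => (hd x).differentiableAt, hη.1⟩
  · exact isCompact_Icc.of_isClosed_subset (isClosed_tsupport _) hsupp
  · exact hsupp.trans (Icc_subset_Ioo ha' hb')

theorem exists_isTestFunction_integral_eq_one (hab : a < b) :
    ∃ θ, IsTestFunction a b θ ∧ ∫ x in Ioo a b, θ x = 1 := by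
  let f : ContDiffBump ((a + b) / 2) :=
    ⟨(b - a) / 8, (b - a) / 4, by linarith, by linarith⟩
  have hsupp : tsupport (f.normed volume) ⊆ Ioo a b := by
    rw [f.tsupport_normed_eq, Real.closedBall_eq_Icc]
    refine Icc_subset_Ioo ?_ ?_ <;> simp only [f] <;> linarith
  have hθ : IsTestFunction a b (f.normed volume) :=
    ⟨f.contDiff_normed, f.hasCompactSupport_normed, hsupp⟩
  refine ⟨f.normed volume, hθ, ?_⟩
  rw [setIntegral_eq_integral_of_forall_compl_eq_zero fun x hx => hθ.eq_zero hx]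
  exact f.integral_normed

/-- A function with zero weak derivative is constant. -/
theorem ae_eq_const_of_isWeakDeriv_zero (hab : a < b) {z : ℝ → ℝ}
    (hz : Integrable z (volume.restrict (Ioo a b)))
    (h : ∀ ψ, IsTestFunction a b ψ → ∫ x in Ioo a b, z x * deriv ψ x = 0) :
    ∃ c : ℝ, z =ᵐ[volume.restrict (Ioo a b)] fun _ => c := by
  obtain ⟨θ, hθ, hθ1⟩ := exists_isTestFunction_integral_eq_one hab
  have hint : ∀ {ψ : ℝ → ℝ}, IsTestFunction a b ψ →
      Integrable (fun x => z x * ψ x) (volume.restrict (Ioo a b)) := by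
    intro ψ hψ
    obtain ⟨C, hC⟩ := hψ.1.continuous.bounded_above_of_compact_support hψ.2.1
    exact hz.mul_bdd (c := C) hψ.1.continuous.aestronglyMeasurable (ae_of_all _ hC)
  have hint' : ∀ {ψ : ℝ → ℝ}, IsTestFunction a b ψ →
      Integrable ψ (volume.restrict (Ioo a b)) := fun hψ =>
    (hψ.1.continuous.integrable_of_hasCompactSupport hψ.2.1).restrict
  refine ⟨∫ x in Ioo a b, z x * θ x, ?_⟩
  have h0 : (fun x => z x - ∫ x in Ioo a b, z x * θ x) =ᵐ[volume.restrict (Ioo a b)] 0 := by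
    refine ae_eq_zero_of_forall_isTestFunction (hz.sub (integrable_const _)) ?_
    intro φ hφ
    set m := ∫ x in Ioo a b, φ x with hm
    -- Subtracting `m θ` removes the mean of `φ`, so the difference is the derivative of a test
    -- function. Testing `z` with it gives `∫ z φ = (∫ z θ) ∫ φ`, which identifies the constant.
    have hη : IsTestFunction a b (fun x => φ x - m * θ x) := by
      refine ⟨hφ.1.sub (contDiff_const.mul hθ.1), hφ.2.1.sub hθ.2.1.mul_left, ?_⟩
      refine (tsupport_sub _ _).trans (union_subset hφ.2.2 ?_)
      exact (tsupport_mul_subset_right (f := fun _ => m) (g := θ)).trans hθ.2.2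
    obtain ⟨ψ, hψ, hψ'⟩ := hη.exists_primitive hab (by
      rw [integral_sub (hint' hφ) ((hint' hθ).const_mul m), integral_const_mul, hθ1, ← hm]
      ring)
    have h1 := h ψ hψ
    rw [hψ'] at h1
    have h2 : ∫ x in Ioo a b, z x * (φ x - m * θ x) =
        ∫ x in Ioo a b, (z x * φ x - m * (z x * θ x)) := by
      congr 1; ext x; ring
    rw [h2, integral_sub (hint hφ) ((hint hθ).const_mul m), integral_const_mul] at h1
    simp only [sub_mul]
    rw [integral_sub (hint hφ) ((hint' hφ).const_mul _), integral_const_mul, ← hm]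
    linarith
  exact h0.mono fun x hx => sub_eq_zero.1 hx

theorem continuousOn_primitive (hab : a ≤ b) (v : L2 a b) :
    ContinuousOn (fun x => ∫ t in a..x, v t) (Icc a b) := by
  have h : IntegrableOn v (Icc a b) := (integrableOn_Icc_iff_integrableOn_Ioo).2 v.integrable
  rw [← uIcc_of_le hab] at h ⊢
  exact intervalIntegral.continuousOn_primitive_interval h

/-- Integration by parts of a primitive against a test function. -/
theorem isWeakDeriv_primitive (hab : a < b) (v : L2 a b) :
    IsWeakDeriv a b (fun x => ∫ t in a..x, v t) v := by
  intro ψ hψ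
  have hv := v.intervalIntegrable (left_mem_Icc.2 hab.le) (right_mem_Icc.2 hab.le)
  -- The primitive is merely absolutely continuous, with derivative `v` almost everywhere; the
  -- boundary terms vanish because `ψ` does at `a` and `b`.
  have h1 := (hv.absolutelyContinuousOnInterval_intervalIntegral (c := a)
    (by simp)).integral_mul_deriv_eq_deriv_mul
    ((hψ.1.of_le (by simp)).contDiffOn.absolutelyContinuousOnInterval (a := a) (b := b))
  rw [hψ.eq_zero (x := a) (by simp), hψ.eq_zero (x := b) (by simp)] at h1
  have h2 : ∫ x in a..b, deriv (fun x => ∫ t in a..x, v t) x * ψ x = ∫ x in a..b, v x * ψ x := by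
    refine intervalIntegral.integral_congr_ae ?_
    filter_upwards [hv.ae_hasDerivAt_integral] with x hx hx'
    rw [(hx (uIoc_subset_uIcc hx') a (by simp)).deriv]
  rw [h2] at h1
  simpa [intervalIntegral.integral_of_le hab.le, integral_Ioc_eq_integral_Ioo] using h1

/-- Every element of `H¹(a, b)` has a representative that is a primitive of its weak
derivative. -/
theorem H1.exists_ae_eq_primitive (hab : a < b) (w : H1 a b) :
    ∃ c : ℝ, w.toL2 =ᵐ[volume.restrict (Ioo a b)] fun x => c + ∫ t in a..x, w.grad t := by
  have hP : Integrable (fun x => ∫ t in a..x, w.grad t) (volume.restrict (Ioo a b)) :=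
    ((continuousOn_primitive hab.le w.grad).integrableOn_Icc).mono_set Ioo_subset_Icc_self
  obtain ⟨c, hc⟩ := ae_eq_const_of_isWeakDeriv_zero hab (w.toL2.integrable.sub hP) (by
    intro ψ hψ
    have hd : Continuous (deriv ψ) := hψ.1.continuous_deriv (by simp)
    obtain ⟨C, hC⟩ := hd.bounded_above_of_compact_support hψ.2.1.deriv
    simp only [Pi.sub_apply, sub_mul]
    rw [integral_sub (hψ.integrable_mul_deriv _)
      (hP.mul_bdd (c := C) hd.aestronglyMeasurable (ae_of_all _ hC)),
      w.isWeakDeriv ψ hψ, isWeakDeriv_primitive hab _ ψ hψ, sub_self])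
  refine ⟨c, hc.mono fun x hx => ?_⟩
  simp only [Pi.sub_apply] at hx
  linarith

/-! ### The Sobolev space `H¹`: weak compactness and embedding into continuous functions -/

/-- The Riesz isometry carries the sequence to the dual, where separability makes closed balls
weak-* sequentially compact; Riesz then carries the limit back. -/
theorem exists_weakly_convergent_subseq {H : Type*} [NormedAddCommGroup H]
    [InnerProductSpace ℝ H] [CompleteSpace H] [TopologicalSpace.SeparableSpace H]
    {W : ℕ → H} {B : ℝ} (hB : ∀ k, ‖W k‖ ≤ B) :
    ∃ (w : H) (σ : ℕ → ℕ), StrictMono σ ∧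
      ∀ l : H →L[ℝ] ℝ, Tendsto (fun j => l (W (σ j))) atTop (𝓝 (l w)) := by
  obtain ⟨φ, -, σ, hσ, hlim⟩ := WeakDual.isSeqCompact_closedBall ℝ H 0 B
    (x := fun k => StrongDual.toWeakDual (InnerProductSpace.toDual ℝ H (W k)))
    (fun k => by simpa using hB k)
  refine ⟨(InnerProductSpace.toDual ℝ H).symm (WeakDual.toStrongDual φ), σ, hσ, fun l => ?_⟩
  have h := ((WeakDual.eval_continuous ((InnerProductSpace.toDual ℝ H).symm l)).tendsto φ).comp hlim
  have e : ∀ z : H, l z = inner ℝ z ((InnerProductSpace.toDual ℝ H).symm l) := fun z => by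
    rw [real_inner_comm, InnerProductSpace.toDual_symm_apply]
  simp only [e, InnerProductSpace.toDual_symm_apply]
  exact h

theorem continuous_integral_mul {η : ℝ → ℝ} (hc : Continuous η) (hs : HasCompactSupport η) :
    Continuous fun u : L2 a b => ∫ x in Ioo a b, u x * η x := by
  have hη : MemLp η 2 (volume.restrict (Ioo a b)) := hc.memLp_of_hasCompactSupport hs
  have : (fun u : L2 a b => ∫ x in Ioo a b, u x * η x) = fun u => inner ℝ u (hη.toLp η) := by
    ext u
    rw [L2.inner_eq_integral]
    exact integral_congr_ae (hη.coeFn_toLp.mono fun x hx => by simp only [hx])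
  rw [this]
  fun_prop

/-- Each test function imposes one equation between `L²`-continuous functionals. Closedness gives
the completeness that the Riesz representation needs. -/
theorem isClosed_sobolevH1 : IsClosed (sobolevH1 a b : Set (WithLp 2 (L2 a b × L2 a b))) := by
  have : (sobolevH1 a b : Set (WithLp 2 (L2 a b × L2 a b))) =
      ⋂ (ψ : ℝ → ℝ) (_ : IsTestFunction a b ψ), {w | ∫ x in Ioo a b, w.fst x * deriv ψ x =
        - ∫ x in Ioo a b, w.snd x * ψ x} := by
    ext w
    simp only [mem_iInter, mem_ofPred_eq]
    rfl
  rw [this]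
  refine isClosed_iInter fun ψ => isClosed_iInter fun hψ => isClosed_eq ?_ ?_
  · exact (continuous_integral_mul (hψ.1.continuous_deriv (by simp)) hψ.2.1.deriv).comp
      (WithLp.fstL 2 ℝ (L2 a b) (L2 a b)).continuous
  · exact ((continuous_integral_mul hψ.1.continuous hψ.2.1).comp
      (WithLp.sndL 2 ℝ (L2 a b) (L2 a b)).continuous).neg

instance : CompleteSpace (H1 a b) := isClosed_sobolevH1.completeSpace_coe

instance : TopologicalSpace.SeparableSpace (H1 a b) := by
  have : Fact ((2 : ENNReal) ≠ ⊤) := ⟨by simp⟩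
  infer_instance

theorem H1.norm_sq_eq (w : H1 a b) : ‖w‖ ^ 2 = ‖w.toL2‖ ^ 2 + ‖w.grad‖ ^ 2 :=
  WithLp.prod_norm_sq_eq_of_L2 w.1

theorem H1.norm_toL2_le (w : H1 a b) : ‖w.toL2‖ ≤ ‖w‖ := by
  refine le_of_sq_le_sq ?_ (norm_nonneg _)
  nlinarith [w.norm_sq_eq, sq_nonneg ‖w.grad‖]

theorem H1.norm_grad_le (w : H1 a b) : ‖w.grad‖ ≤ ‖w‖ := by
  refine le_of_sq_le_sq ?_ (norm_nonneg _)
  nlinarith [w.norm_sq_eq, sq_nonneg ‖w.toL2‖]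

/-- The weak derivative as a bounded operator on `H¹`. -/
def H1.gradL : H1 a b →L[ℝ] L2 a b :=
  (WithLp.sndL 2 ℝ (L2 a b) (L2 a b)).comp (sobolevH1 a b).subtypeL

theorem H1.exists_continuousOn_ae_eq (hab : a < b) (w : H1 a b) :
    ∃ f : ℝ → ℝ, ContinuousOn f (Ioo a b) ∧ w.toL2 =ᵐ[volume.restrict (Ioo a b)] f := by
  obtain ⟨c, hc⟩ := w.exists_ae_eq_primitive hab
  exact ⟨_, continuousOn_const.add
    ((continuousOn_primitive hab.le w.grad).mono Ioo_subset_Icc_self), hc⟩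

theorem H1.continuousOn_pointValue (hab : a < b) (w : H1 a b) :
    ContinuousOn (pointValue w.toL2) (Ioo a b) := by
  have h := w.exists_continuousOn_ae_eq hab
  have e : pointValue w.toL2 = h.choose := by
    ext x
    rw [pointValue, dif_pos h]
  rw [e]
  exact h.choose_spec.1

theorem H1.ae_eq_pointValue (hab : a < b) (w : H1 a b) :
    w.toL2 =ᵐ[volume.restrict (Ioo a b)] pointValue w.toL2 := by
  have h := w.exists_continuousOn_ae_eq hab
  have e : pointValue w.toL2 = h.choose := by
    ext x
    rw [pointValue, dif_pos h]
  rw [e]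
  exact h.choose_spec.2

/-- Continuous functions equal almost everywhere on an open set agree on it. The arbitrary
representative chosen in `pointValue` can thus be replaced by any convenient one, such as a
primitive of the gradient. -/
theorem H1.pointValue_eqOn (hab : a < b) (w : H1 a b) {f : ℝ → ℝ} (hf : ContinuousOn f (Ioo a b))
    (h : w.toL2 =ᵐ[volume.restrict (Ioo a b)] f) : EqOn (pointValue w.toL2) f (Ioo a b) :=
  Measure.eqOn_open_of_ae_eq ((w.ae_eq_pointValue hab).symm.trans h) isOpen_Ioo
    (w.continuousOn_pointValue hab) hf

theorem H1.pointValue_add (hab : a < b) (w z : H1 a b) {x : ℝ} (hx : x ∈ Ioo a b) :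
    pointValue (w + z).toL2 x = pointValue w.toL2 x + pointValue z.toL2 x := by
  refine (w + z).pointValue_eqOn hab (f := fun x => pointValue w.toL2 x + pointValue z.toL2 x)
    ((w.continuousOn_pointValue hab).add (z.continuousOn_pointValue hab)) ?_ hx
  filter_upwards [Lp.coeFn_add w.toL2 z.toL2, w.ae_eq_pointValue hab, z.ae_eq_pointValue hab]
    with x h1 h2 h3
  rw [← h2, ← h3]
  exact h1

theorem H1.pointValue_smul (hab : a < b) (c : ℝ) (w : H1 a b) {x : ℝ} (hx : x ∈ Ioo a b) :
    pointValue (c • w).toL2 x = c * pointValue w.toL2 x := by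
  refine (c • w).pointValue_eqOn hab (f := fun x => c * pointValue w.toL2 x)
    (continuousOn_const.mul (w.continuousOn_pointValue hab)) ?_ hx
  filter_upwards [Lp.coeFn_smul c w.toL2, w.ae_eq_pointValue hab] with x h1 h2
  rw [← h2]
  exact h1

/-- The `1/2`-Hölder estimate in `H¹`. -/
theorem H1.abs_pointValue_sub_le (hab : a < b) (w : H1 a b) {x y : ℝ} (hx : x ∈ Ioo a b)
    (hy : y ∈ Ioo a b) :
    |pointValue w.toL2 y - pointValue w.toL2 x| ≤ √|y - x| * ‖w‖ := by
  obtain ⟨c, hc⟩ := w.exists_ae_eq_primitive hab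
  have he := w.pointValue_eqOn hab (f := fun x => c + ∫ t in a..x, w.grad t)
    (continuousOn_const.add
    ((continuousOn_primitive hab.le w.grad).mono Ioo_subset_Icc_self)) hc
  have ha : a ∈ Icc a b := left_mem_Icc.2 hab.le
  have hx' := Ioo_subset_Icc_self hx
  have hy' := Ioo_subset_Icc_self hy
  rw [he hx, he hy, add_sub_add_left_eq_sub, intervalIntegral.integral_interval_sub_left
    (w.grad.intervalIntegrable ha hy') (w.grad.intervalIntegrable ha hx')]
  exact (w.grad.abs_intervalIntegral_le hx' hy').trans
    (mul_le_mul_of_nonneg_left w.norm_grad_le (Real.sqrt_nonneg _))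

/-- The norm of the embedding of `H¹(a, b)` into continuous functions is at most this number. -/
def embeddingConst (a b : ℝ) : ℝ := √(2 / (b - a) + 2 * (b - a))

/-- The Hölder estimate compares the value at `x` with the value at any `y`; integrating the squared
comparison over `y` leaves the `L²` norm. -/
theorem H1.abs_pointValue_le (hab : a < b) (w : H1 a b) {x : ℝ} (hx : x ∈ Ioo a b) :
    |pointValue w.toL2 x| ≤ embeddingConst a b * ‖w‖ := by
  have hL : 0 < b - a := sub_pos.2 hab
  have h1 : ∀ᵐ y ∂(volume.restrict (Ioo a b)),
      pointValue w.toL2 x ^ 2 ≤ 2 * w.toL2 y ^ 2 + 2 * (b - a) * ‖w‖ ^ 2 := by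
    filter_upwards [w.ae_eq_pointValue hab, ae_restrict_mem measurableSet_Ioo] with y h1 hy
    rw [h1]
    have h2 := w.abs_pointValue_sub_le hab hy hx
    have h3 : (pointValue w.toL2 x - pointValue w.toL2 y) ^ 2 ≤ (b - a) * ‖w‖ ^ 2 := by
      rw [← sq_abs]
      refine (pow_le_pow_left₀ (abs_nonneg _) h2 2).trans ?_
      rw [mul_pow, Real.sq_sqrt (abs_nonneg _)]
      refine mul_le_mul_of_nonneg_right ?_ (sq_nonneg _)
      rw [abs_le]
      constructor <;> linarith [hx.1, hx.2, hy.1, hy.2]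
    -- `p² ≤ 2 r² + 2 (p - r)²`, since the difference of the two sides is `(p - 2r)²`.
    nlinarith [sq_nonneg (pointValue w.toL2 x - 2 * pointValue w.toL2 y)]
  have h2 := integral_mono_ae (integrable_const _)
    (((L2.integrable_sq w.toL2).const_mul 2).add (integrable_const _)) h1
  simp only [Pi.add_apply] at h2
  rw [integral_add ((L2.integrable_sq w.toL2).const_mul 2) (integrable_const _),
    integral_const_mul, ← L2.norm_sq_eq_integral] at h2
  simp only [integral_const, measureReal_restrict_apply_univ, Real.volume_real_Ioo_of_le hab.le,
    smul_eq_mul] at h2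
  have h3 : pointValue w.toL2 x ^ 2 ≤ (2 / (b - a) + 2 * (b - a)) * ‖w‖ ^ 2 := by
    have h4 : ‖w.toL2‖ ^ 2 ≤ ‖w‖ ^ 2 := pow_le_pow_left₀ (norm_nonneg _) w.norm_toL2_le 2
    have h5 : (2 / (b - a) + 2 * (b - a)) * ‖w‖ ^ 2
        = (2 * ‖w‖ ^ 2 + (b - a) * (2 * (b - a) * ‖w‖ ^ 2)) / (b - a) := by
      field_simp
    rw [h5, le_div_iff₀ hL]
    linarith
  rw [embeddingConst]
  refine abs_le_of_sq_le_sq ?_ (by positivity)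
  rwa [mul_pow, Real.sq_sqrt (by positivity)]

/-- Evaluation at an interior point, as a bounded functional on `H¹(a, b)`. -/
def H1.evalL (hab : a < b) {x : ℝ} (hx : x ∈ Ioo a b) : H1 a b →L[ℝ] ℝ :=
  LinearMap.mkContinuous
    { toFun := fun w => pointValue w.toL2 x
      map_add' := fun w z => w.pointValue_add hab z hx
      map_smul' := fun c w => w.pointValue_smul hab c hx }
    (embeddingConst a b) fun w => w.abs_pointValue_le hab hx

/-- Evaluation at an interior point is a bounded functional, so weak convergence already controls
point values. -/
theorem H1.tendsto_pointValue (hab : a < b) {W : ℕ → H1 a b} {w : H1 a b}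
    (hW : ∀ l : H1 a b →L[ℝ] ℝ, Tendsto (fun j => l (W j)) atTop (𝓝 (l w)))
    {x : ℝ} (hx : x ∈ Ioo a b) :
    Tendsto (fun j => pointValue (W j).toL2 x) atTop (𝓝 (pointValue w.toL2 x)) :=
  hW (H1.evalL hab hx)

theorem H1.ae_tendsto_of_weak (hab : a < b) {W : ℕ → H1 a b} {w : H1 a b}
    (hW : ∀ l : H1 a b →L[ℝ] ℝ, Tendsto (fun j => l (W j)) atTop (𝓝 (l w))) :
    ∀ᵐ x ∂(volume.restrict (Ioo a b)),
      Tendsto (fun j => (W j).toL2 x) atTop (𝓝 (w.toL2 x)) := by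
  filter_upwards [ae_all_iff.2 fun j => (W j).ae_eq_pointValue hab, w.ae_eq_pointValue hab,
    ae_restrict_mem measurableSet_Ioo] with x h1 h2 hx
  simp only [h1, h2]
  exact H1.tendsto_pointValue hab hW hx

theorem H1.ae_abs_toL2_le (hab : a < b) (w : H1 a b) :
    ∀ᵐ x ∂(volume.restrict (Ioo a b)), |w.toL2 x| ≤ embeddingConst a b * ‖w‖ := by
  filter_upwards [w.ae_eq_pointValue hab, ae_restrict_mem measurableSet_Ioo] with x h1 hx
  rw [h1]
  exact w.abs_pointValue_le hab hx

theorem embeddingConst_nonneg : 0 ≤ embeddingConst a b := Real.sqrt_nonneg _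

theorem H1.ae_abs_toL2_le_of_norm_le (hab : a < b) {w : H1 a b} {B : ℝ} (hB : ‖w‖ ≤ B) :
    ∀ᵐ x ∂(volume.restrict (Ioo a b)), |w.toL2 x| ≤ embeddingConst a b * B :=
  (w.ae_abs_toL2_le hab).mono fun _ hx =>
    hx.trans (mul_le_mul_of_nonneg_left hB embeddingConst_nonneg)

/-- The embedding bound supplies a constant majorant, and pointwise convergence does the rest: a
one-dimensional substitute for Rellich's theorem. -/
theorem H1.tendsto_toL2_of_weak (hab : a < b) {W : ℕ → H1 a b} {w : H1 a b} {B : ℝ}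
    (hB : ∀ j, ‖W j‖ ≤ B)
    (hW : ∀ l : H1 a b →L[ℝ] ℝ, Tendsto (fun j => l (W j)) atTop (𝓝 (l w))) :
    Tendsto (fun j => (W j).toL2) atTop (𝓝 w.toL2) :=
  L2.tendsto_of_dominated (memLp_const (embeddingConst a b * B))
    (fun j => H1.ae_abs_toL2_le_of_norm_le hab (hB j)) (H1.ae_tendsto_of_weak hab hW)

/-! ### The phase field -/

theorem hasDerivAt_tanh (x : ℝ) : HasDerivAt Real.tanh (1 / Real.cosh x ^ 2) x := by
  have h := (Real.hasDerivAt_sinh x).div (Real.hasDerivAt_cosh x) (Real.cosh_pos x).ne'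
  have e : Real.tanh = Real.sinh / Real.cosh := funext Real.tanh_eq_sinh_div_cosh
  rw [e]
  have e' : Real.cosh x * Real.cosh x - Real.sinh x * Real.sinh x = 1 := by
    nlinarith [Real.cosh_sq x]
  rwa [e'] at h

theorem tanh_eq_one_sub (x : ℝ) : Real.tanh x = 1 - 2 / (Real.exp (2 * x) + 1) := by
  have h := Real.exp_pos x
  rw [Real.tanh_eq, Real.exp_neg, two_mul, Real.exp_add]
  field_simp
  ring

theorem tendsto_tanh_atTop : Tendsto Real.tanh atTop (𝓝 1) := by
  have h1 : Tendsto (fun x : ℝ => Real.exp (2 * x) + 1) atTop atTop :=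
    tendsto_atTop_add_const_right _ _
      (Real.tendsto_exp_atTop.comp (tendsto_id.const_mul_atTop two_pos))
  have h2 := (h1.const_div_atTop 2).const_sub 1
  rw [sub_zero] at h2
  exact h2.congr fun x => (tanh_eq_one_sub x).symm

theorem tendsto_tanh_atBot : Tendsto Real.tanh atBot (𝓝 (-1)) := by
  have h := (tendsto_tanh_atTop.comp tendsto_neg_atBot_atTop).neg
  exact h.congr fun x => by simp [Real.tanh_neg]

theorem continuous_tanh : Continuous Real.tanh :=
  continuous_iff_continuousAt.2 fun x => (hasDerivAt_tanh x).continuousAt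

/-- The profile `½ sech²` of the derivative of the phase field. -/
def sechKernel (y : ℝ) : ℝ := 1 / (2 * Real.cosh y ^ 2)

theorem sechKernel_nonneg (y : ℝ) : 0 ≤ sechKernel y := by
  unfold sechKernel; positivity

theorem sechKernel_neg (y : ℝ) : sechKernel (-y) = sechKernel y := by
  simp [sechKernel]

theorem continuous_sechKernel : Continuous sechKernel := by
  unfold sechKernel
  exact continuous_const.div (by fun_prop) fun y => by
    have := Real.cosh_pos y
    positivity

theorem hasDerivAt_half_tanh (y : ℝ) :
    HasDerivAt (fun y => 1 / 2 * (1 + Real.tanh y)) (sechKernel y) y := by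
  have h := ((hasDerivAt_tanh y).const_add 1).const_mul (1 / 2)
  rwa [one_div_mul_one_div] at h

/-- On the positive half-line the kernel is a nonnegative derivative of a function with a finite
limit; evenness covers the other half. -/
theorem integrable_sechKernel : Integrable sechKernel := by
  have h1 : IntegrableOn sechKernel (Ioi 0) :=
    integrableOn_Ioi_deriv_of_nonneg' (fun y _ => hasDerivAt_half_tanh y)
      (fun y _ => sechKernel_nonneg y) ((tendsto_tanh_atTop.const_add 1).const_mul (1 / 2))
  rw [← integrableOn_univ, ← Iic_union_Ioi (a := (0 : ℝ))]
  refine IntegrableOn.union ?_ ?_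
  · have h2 := ((Measure.measurePreserving_neg (volume : Measure ℝ)).integrableOn_comp_preimage
      (MeasurableEquiv.neg ℝ).measurableEmbedding).2 ((integrableOn_Ici_iff_integrableOn_Ioi).2 h1)
    simpa [Function.comp_def, sechKernel_neg] using h2
  · exact h1

theorem integral_sechKernel : ∫ y, sechKernel y = 1 := by
  rw [integral_of_hasDerivAt_of_tendsto hasDerivAt_half_tanh integrable_sechKernel
    ((tendsto_tanh_atBot.const_add 1).const_mul (1 / 2))
    ((tendsto_tanh_atTop.const_add 1).const_mul (1 / 2))]
  norm_num

theorem integral_mul_sechKernel_rescale (V : ℝ → ℝ) (c : ℝ) (hε : 0 < ε) :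
    ∫ x, V x * (ε⁻¹ * sechKernel ((x - c) / ε)) = ∫ y, V (c + ε * y) * sechKernel y := by
  have h1 := Measure.integral_comp_mul_left
    (fun z => V (c + z) * sechKernel ((c + z - c) / ε)) ε
  have h2 := integral_add_left_eq_self (μ := (volume : Measure ℝ))
    (fun x => V x * sechKernel ((x - c) / ε)) c
  rw [h2, abs_of_pos (inv_pos.2 hε), smul_eq_mul, ← integral_const_mul] at h1
  refine Eq.trans ?_ (h1.symm.trans ?_)
  · congr 1; ext x; ring
  · congr 1; ext y
    rw [add_sub_cancel_left, mul_div_cancel_left₀ _ hε.ne']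

theorem integrable_sechKernel_rescale (c : ℝ) (hε : 0 < ε) :
    Integrable fun x => ε⁻¹ * sechKernel ((x - c) / ε) :=
  (((integrable_sechKernel.comp_div hε.ne').comp_sub_right c)).const_mul _

theorem integral_sechKernel_rescale (c : ℝ) (hε : 0 < ε) :
    ∫ x, ε⁻¹ * sechKernel ((x - c) / ε) = 1 := by
  have := integral_mul_sechKernel_rescale (fun _ => 1) c hε
  simpa only [one_mul, integral_sechKernel] using this

/-- The rescaled kernels concentrate at `c`. -/
theorem tendsto_integral_mul_sechKernel {ε : ℕ → ℝ} (hε : ∀ k, 0 < ε k) {V : ℕ → ℝ → ℝ}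
    {c C L : ℝ} (hm : ∀ k, Measurable (V k)) (hC : ∀ k x, |V k x| ≤ C)
    (hlim : ∀ y, Tendsto (fun k => V k (c + ε k * y)) atTop (𝓝 L)) :
    Tendsto (fun k => ∫ x, V k x * ((ε k)⁻¹ * sechKernel ((x - c) / ε k))) atTop (𝓝 L) := by
  simp only [integral_mul_sechKernel_rescale _ _ (hε _)]
  have e : L = ∫ y, L * sechKernel y := by
    rw [integral_const_mul, integral_sechKernel, mul_one]
  rw [e]
  refine tendsto_integral_of_dominated_convergence (fun y => C * sechKernel y) (fun k => ?_)
    (integrable_sechKernel.const_mul C) (fun k => ae_of_all _ fun y => ?_)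
    (ae_of_all _ fun y => (hlim y).mul_const _)
  · exact (((hm k).comp (by fun_prop)).mul
      continuous_sechKernel.measurable).aestronglyMeasurable
  · rw [Real.norm_eq_abs, abs_mul, abs_of_nonneg (sechKernel_nonneg y)]
    exact mul_le_mul_of_nonneg_right (hC k _) (sechKernel_nonneg y)

/-- The minimum switches branch only at the midpoint of `a₁` and `b₁`. On either side of it `φ_ε` is
a single translated, possibly reflected, `tanh` profile, so `|φ_ε'|` is a single rescaled kernel. -/
theorem signedDistance_eq (h : a₁ < b₁) (x : ℝ) :
    signedDistance a₁ b₁ x = min (x - a₁) (b₁ - x) := by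
  have hd : Metric.infDist x ({a₁, b₁} : Set ℝ) = min |x - a₁| |x - b₁| := by
    have hne : ({a₁, b₁} : Set ℝ).Nonempty := ⟨a₁, by simp⟩
    refine le_antisymm (le_min ?_ ?_) ((Metric.le_infDist hne).2 fun y hy => ?_)
    · exact Metric.infDist_le_dist_of_mem (by simp)
    · exact Metric.infDist_le_dist_of_mem (by simp)
    · rcases hy with rfl | rfl
      · exact min_le_left _ _
      · exact min_le_right _ _
  rw [signedDistance, frontier_Ioo h, hd]
  split_ifs with hx
  · rw [abs_of_pos (sub_pos.2 hx.1), abs_of_neg (sub_neg.2 hx.2), neg_sub]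
  · rcases le_or_gt x a₁ with h1 | h1
    · rw [abs_of_nonpos (by linarith), abs_of_neg (by linarith), min_eq_left (by linarith),
        min_eq_left (by linarith)]
      ring
    · have h2 : b₁ ≤ x := not_lt.1 fun h2 => hx ⟨h1, h2⟩
      rw [abs_of_nonneg (by linarith), abs_of_nonneg (by linarith), min_eq_right (by linarith),
        min_eq_right (by linarith)]
      ring

theorem continuous_phaseField (h : a₁ < b₁) : Continuous (phaseField a₁ b₁ ε) := by
  have e : phaseField a₁ b₁ ε = fun x => 1 / 2 * (1 + Real.tanh (min (x - a₁) (b₁ - x) / ε)) := by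
    ext x
    rw [phaseField, signedDistance_eq h]
  rw [e]
  have := continuous_tanh
  fun_prop

theorem phaseField_mem_Icc (x : ℝ) : phaseField a₁ b₁ ε x ∈ Icc (0 : ℝ) 1 := by
  unfold phaseField
  constructor
  · linarith [Real.neg_one_lt_tanh (signedDistance a₁ b₁ x / ε)]
  · linarith [Real.tanh_lt_one (signedDistance a₁ b₁ x / ε)]

theorem tendsto_phaseField (h : a₁ < b₁) {ε : ℕ → ℝ} (hε : ∀ k, 0 < ε k)
    (hlim : Tendsto ε atTop (𝓝 0)) {x : ℝ} (ha : x ≠ a₁) (hb : x ≠ b₁) :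
    Tendsto (fun k => phaseField a₁ b₁ (ε k) x) atTop (𝓝 ((Ioo a₁ b₁).indicator 1 x)) := by
  have hinv : Tendsto (fun k => (ε k)⁻¹) atTop atTop :=
    tendsto_inv_nhdsGT_zero.comp
      (tendsto_nhdsWithin_iff.2 ⟨hlim, Eventually.of_forall hε⟩)
  unfold phaseField
  rw [signedDistance_eq h]
  by_cases hx : x ∈ Ioo a₁ b₁
  · have hp : 0 < min (x - a₁) (b₁ - x) := lt_min (sub_pos.2 hx.1) (sub_pos.2 hx.2)
    have := ((tendsto_tanh_atTop.comp (hinv.const_mul_atTop hp)).const_add 1).const_mul (1 / 2)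
    rw [indicator_of_mem hx]
    norm_num at this
    simpa [Function.comp_def, div_eq_mul_inv] using this
  · have hn : min (x - a₁) (b₁ - x) < 0 := by
      rw [min_lt_iff]
      by_contra! hc
      exact hx ⟨lt_of_le_of_ne (by linarith) ha.symm, lt_of_le_of_ne (by linarith) hb⟩
    have := ((tendsto_tanh_atBot.comp (hinv.const_mul_atTop_of_neg hn)).const_add 1).const_mul
      (1 / 2)
    rw [indicator_of_notMem hx]
    simpa [Function.comp_def, div_eq_mul_inv] using this

theorem hasDerivAt_phaseField_left (h : a₁ < b₁) {x : ℝ} (hx : x < (a₁ + b₁) / 2) :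
    HasDerivAt (phaseField a₁ b₁ ε) (ε⁻¹ * sechKernel ((x - a₁) / ε)) x := by
  have h1 := (hasDerivAt_half_tanh ((x - a₁) / ε)).comp x
    (((hasDerivAt_id x).sub_const a₁).div_const ε)
  rw [mul_comm, one_div ε] at h1
  refine h1.congr_of_eventuallyEq ?_
  filter_upwards [Iio_mem_nhds hx] with y hy
  have hy' : y < (a₁ + b₁) / 2 := hy
  rw [phaseField, signedDistance_eq h, min_eq_left (by linarith)]
  rfl

theorem hasDerivAt_phaseField_right (h : a₁ < b₁) {x : ℝ} (hx : (a₁ + b₁) / 2 < x) :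
    HasDerivAt (phaseField a₁ b₁ ε) (-(ε⁻¹ * sechKernel ((x - b₁) / ε))) x := by
  have h1 := (hasDerivAt_half_tanh ((b₁ - x) / ε)).comp x
    (((hasDerivAt_id x).const_sub b₁).div_const ε)
  have e : sechKernel ((b₁ - x) / ε) * (-1 / ε) = -(ε⁻¹ * sechKernel ((x - b₁) / ε)) := by
    rw [← sechKernel_neg ((x - b₁) / ε), ← neg_div, neg_sub]
    ring
  rw [e] at h1
  refine h1.congr_of_eventuallyEq ?_
  filter_upwards [Ioi_mem_nhds hx] with y hy
  have hy' : (a₁ + b₁) / 2 < y := hy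
  rw [phaseField, signedDistance_eq h, min_eq_right (by linarith)]
  rfl

theorem abs_deriv_phaseField_left (h : a₁ < b₁) (hε : 0 < ε) {x : ℝ} (hx : x < (a₁ + b₁) / 2) :
    |deriv (phaseField a₁ b₁ ε) x| = ε⁻¹ * sechKernel ((x - a₁) / ε) := by
  rw [(hasDerivAt_phaseField_left h hx).deriv, abs_of_nonneg]
  exact mul_nonneg (inv_nonneg.2 hε.le) (sechKernel_nonneg _)

theorem abs_deriv_phaseField_right (h : a₁ < b₁) (hε : 0 < ε) {x : ℝ}
    (hx : (a₁ + b₁) / 2 < x) :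
    |deriv (phaseField a₁ b₁ ε) x| = ε⁻¹ * sechKernel ((x - b₁) / ε) := by
  rw [(hasDerivAt_phaseField_right h hx).deriv, abs_neg, abs_of_nonneg]
  exact mul_nonneg (inv_nonneg.2 hε.le) (sechKernel_nonneg _)

theorem ae_abs_deriv_phaseField_le (h : a₁ < b₁) (hε : 0 < ε) :
    ∀ᵐ x, |deriv (phaseField a₁ b₁ ε) x| ≤
      ε⁻¹ * sechKernel ((x - a₁) / ε) + ε⁻¹ * sechKernel ((x - b₁) / ε) := by
  filter_upwards [Measure.ae_ne volume ((a₁ + b₁) / 2)] with x hx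
  have hp : ∀ y, 0 ≤ ε⁻¹ * sechKernel y := fun y =>
    mul_nonneg (inv_nonneg.2 hε.le) (sechKernel_nonneg _)
  rcases lt_or_gt_of_ne hx with h1 | h1
  · rw [abs_deriv_phaseField_left h hε h1]
    linarith [hp ((x - b₁) / ε)]
  · rw [abs_deriv_phaseField_right h hε h1]
    linarith [hp ((x - a₁) / ε)]

theorem integrable_abs_deriv_phaseField (h : a₁ < b₁) (hε : 0 < ε) :
    Integrable fun x => |deriv (phaseField a₁ b₁ ε) x| := by
  refine ((integrable_sechKernel_rescale a₁ hε).add (integrable_sechKernel_rescale b₁ hε)).mono'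
    (measurable_deriv _).abs.aestronglyMeasurable ?_
  filter_upwards [ae_abs_deriv_phaseField_le h hε] with x hx
  rw [Real.norm_eq_abs, abs_abs]
  exact hx

/-- The bound `2` is the total mass of the two kernels, whatever `ε` is. -/
theorem integral_abs_deriv_phaseField_le (h : a₁ < b₁) (hε : 0 < ε) :
    ∫ x in Ioo a b, |deriv (phaseField a₁ b₁ ε) x| ≤ 2 := by
  refine (setIntegral_le_integral (integrable_abs_deriv_phaseField h hε)
    (ae_of_all _ fun x => abs_nonneg _)).trans ?_
  refine (integral_mono_ae (integrable_abs_deriv_phaseField h hε)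
    ((integrable_sechKernel_rescale a₁ hε).add (integrable_sechKernel_rescale b₁ hε))
    (ae_abs_deriv_phaseField_le h hε)).trans ?_
  simp only [Pi.add_apply]
  rw [integral_add (integrable_sechKernel_rescale a₁ hε) (integrable_sechKernel_rescale b₁ hε),
    integral_sechKernel_rescale a₁ hε, integral_sechKernel_rescale b₁ hε]
  norm_num

/-! ### Convergence of the coefficients -/

theorem abs_convex_combination_le {s t θ : ℝ} (hθ : θ ∈ Icc (0 : ℝ) 1) :
    |s + (t - s) * θ| ≤ |s| + |t| := by
  have h1 : s + (t - s) * θ = (1 - θ) * s + θ * t := by ring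
  rw [h1]
  refine (abs_add_le _ _).trans ?_
  rw [abs_mul, abs_mul, abs_of_nonneg hθ.1, abs_of_nonneg (sub_nonneg.2 hθ.2)]
  nlinarith [abs_nonneg s, abs_nonneg t, hθ.1, hθ.2]

theorem abs_diffuse_le (s t : ℝ → ℝ) (x : ℝ) : |diffuse a₁ b₁ ε s t x| ≤ |s x| + |t x| :=
  abs_convex_combination_le (phaseField_mem_Icc x)

theorem le_diffuse_const {m s t : ℝ} (hs : m ≤ s) (ht : m ≤ t) (x : ℝ) :
    m ≤ diffuse a₁ b₁ ε (fun _ => s) (fun _ => t) x := by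
  have h := phaseField_mem_Icc (a₁ := a₁) (b₁ := b₁) (ε := ε) x
  unfold diffuse
  nlinarith [h.1, h.2]

/-- This puts the sharp coefficient in the form of `diffuse`, with the indicator of `Ω₁` in place of
`φ_ε`; the formula may fail only at the null points `a₁`, `b₁`. -/
theorem ae_sharp_eq (s t : ℝ → ℝ) :
    ∀ᵐ x ∂(volume.restrict (Ioo a b)),
      sharp a a₁ b₁ b s t x = s x + (t x - s x) * (Ioo a₁ b₁).indicator 1 x := by
  filter_upwards [ae_restrict_mem measurableSet_Ioo, Measure.ae_ne _ a₁, Measure.ae_ne _ b₁]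
    with x hx ha hb
  unfold sharp
  by_cases hx₁ : x ∈ Ioo a₁ b₁
  · have hx₂ : x ∉ Ioo a a₁ ∪ Ioo b₁ b := by
      rintro (h2 | h2)
      · exact lt_asymm h2.2 hx₁.1
      · exact lt_asymm h2.1 hx₁.2
    simp [hx₁, hx₂]
  · have hx₂ : x ∈ Ioo a a₁ ∪ Ioo b₁ b := by
      rcases lt_or_gt_of_ne ha with h1 | h1
      · exact Or.inl ⟨hx.1, h1⟩
      · exact Or.inr ⟨lt_of_le_of_ne (not_lt.1 fun h2 => hx₁ ⟨h1, h2⟩) hb.symm, hx.2⟩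
    simp [hx₁, hx₂]

theorem ae_tendsto_diffuse (h : a₁ < b₁) (s t : ℝ → ℝ)
    {ε : ℕ → ℝ} (hε : ∀ k, 0 < ε k) (hlim : Tendsto ε atTop (𝓝 0)) :
    ∀ᵐ x ∂(volume.restrict (Ioo a b)),
      Tendsto (fun k => diffuse a₁ b₁ (ε k) s t x) atTop (𝓝 (sharp a a₁ b₁ b s t x)) := by
  filter_upwards [ae_sharp_eq s t, Measure.ae_ne _ a₁, Measure.ae_ne _ b₁]
    with x hx ha hb
  rw [hx]
  exact ((tendsto_phaseField h hε hlim ha hb).const_mul _).const_add _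

theorem ae_abs_sharp_le (s t : ℝ → ℝ) :
    ∀ᵐ x ∂(volume.restrict (Ioo a b)), |sharp a a₁ b₁ b s t x| ≤ |s x| + |t x| := by
  filter_upwards [ae_sharp_eq s t] with x hx
  rw [hx]
  refine abs_convex_combination_le ?_
  by_cases hx : x ∈ Ioo a₁ b₁ <;> simp [hx]

theorem aestronglyMeasurable_diffuse (h : a₁ < b₁) {s t : ℝ → ℝ} {μ : Measure ℝ}
    (hs : AEStronglyMeasurable s μ) (ht : AEStronglyMeasurable t μ) :
    AEStronglyMeasurable (diffuse a₁ b₁ ε s t) μ :=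
  hs.add ((ht.sub hs).mul (continuous_phaseField h).aestronglyMeasurable)

theorem aestronglyMeasurable_sharp {s t : ℝ → ℝ} {μ : Measure ℝ}
    (hs : AEStronglyMeasurable s μ) (ht : AEStronglyMeasurable t μ) :
    AEStronglyMeasurable (sharp a a₁ b₁ b s t) μ :=
  (ht.indicator measurableSet_Ioo).add (hs.indicator (measurableSet_Ioo.union measurableSet_Ioo))

/-! ### The individual terms of the energy -/

theorem memLp_diffuse_mul (h : a₁ < b₁) (s t : ℝ) (z : L2 a b) :
    MemLp (fun x => diffuse a₁ b₁ ε (fun _ => s) (fun _ => t) x * z x) 2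
      (volume.restrict (Ioo a b)) := by
  refine (Lp.memLp z).of_le_mul (c := |s| + |t|) ((aestronglyMeasurable_diffuse h
    aestronglyMeasurable_const aestronglyMeasurable_const).mul (Lp.aestronglyMeasurable z)) ?_
  refine ae_of_all _ fun x => ?_
  rw [norm_mul]
  exact mul_le_mul_of_nonneg_right (abs_diffuse_le _ _ x) (norm_nonneg _)

theorem memLp_sharp_mul (s t : ℝ) (z : L2 a b) :
    MemLp (fun x => sharp a a₁ b₁ b (fun _ => s) (fun _ => t) x * z x) 2
      (volume.restrict (Ioo a b)) := by
  refine (Lp.memLp z).of_le_mul (c := |s| + |t|) ((aestronglyMeasurable_sharp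
    aestronglyMeasurable_const aestronglyMeasurable_const).mul (Lp.aestronglyMeasurable z)) ?_
  filter_upwards [ae_abs_sharp_le (fun _ => s) (fun _ => t)] with x hx
  rw [norm_mul]
  exact mul_le_mul_of_nonneg_right hx (norm_nonneg _)

theorem integrable_diffuse_mul_mul (h : a₁ < b₁) (s t : ℝ) (y z : L2 a b) :
    Integrable (fun x => diffuse a₁ b₁ ε (fun _ => s) (fun _ => t) x * z x * y x)
      (volume.restrict (Ioo a b)) :=
  (memLp_diffuse_mul h s t z).integrable_mul (q := 2) (Lp.memLp y)

theorem integrable_sharp_mul_mul (s t : ℝ) (y z : L2 a b) :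
    Integrable (fun x => sharp a a₁ b₁ b (fun _ => s) (fun _ => t) x * z x * y x)
      (volume.restrict (Ioo a b)) :=
  (memLp_sharp_mul s t z).integrable_mul (q := 2) (Lp.memLp y)

theorem memLp_diffuse (h : a₁ < b₁) (s t : L2 a b) :
    MemLp (diffuse a₁ b₁ ε s t) 2 (volume.restrict (Ioo a b)) := by
  refine ((Lp.memLp s).norm.add (Lp.memLp t).norm).of_le (aestronglyMeasurable_diffuse h
    (Lp.aestronglyMeasurable s) (Lp.aestronglyMeasurable t)) (ae_of_all _ fun x => ?_)
  exact (abs_diffuse_le _ _ x).trans (le_abs_self _)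

theorem memLp_sharp (s t : L2 a b) :
    MemLp (sharp a a₁ b₁ b s t) 2 (volume.restrict (Ioo a b)) := by
  refine ((Lp.memLp s).norm.add (Lp.memLp t).norm).of_le (aestronglyMeasurable_sharp
    (Lp.aestronglyMeasurable s) (Lp.aestronglyMeasurable t)) ?_
  filter_upwards [ae_abs_sharp_le s t] with x hx
  exact hx.trans (le_abs_self _)

theorem integrable_boundaryTerm (hab : a < b) (h : a₁ < b₁) (hε : 0 < ε) (g u : H1 a b) :
    Integrable (fun x => (1 / 2 * κ * u.toL2 x ^ 2 + g.toL2 x * u.toL2 x) *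
      |deriv (phaseField a₁ b₁ ε) x|) (volume.restrict (Ioo a b)) := by
  refine (integrable_abs_deriv_phaseField h hε).restrict.bdd_mul
    (c := |1 / 2 * κ| * (embeddingConst a b * ‖u‖) ^ 2
      + (embeddingConst a b * ‖g‖) * (embeddingConst a b * ‖u‖)) ?_ ?_
  · exact (((L2.integrable_sq u.toL2).const_mul _).add
      (L2.integrable_mul g.toL2 u.toL2)).aestronglyMeasurable
  · filter_upwards [u.ae_abs_toL2_le hab, g.ae_abs_toL2_le hab] with x h1 h2
    rw [Real.norm_eq_abs]
    refine (abs_add_le _ _).trans ?_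
    rw [abs_mul, abs_mul (g.toL2 x), abs_pow]
    have h3 := (abs_nonneg _).trans h2
    gcongr

/-- A strong–weak pairing: the coefficient times the fixed `z` converges strongly in `L²` by
domination, while the gradients are bounded and converge weakly. -/
theorem tendsto_integral_diffuse_mul_grad (h : a₁ < b₁)
    (s t : ℝ) {ε : ℕ → ℝ} (hε : ∀ k, 0 < ε k) (hlim : Tendsto ε atTop (𝓝 0))
    {W : ℕ → H1 a b} {w : H1 a b} {B : ℝ} (hB : ∀ j, ‖W j‖ ≤ B)
    (hW : ∀ l : H1 a b →L[ℝ] ℝ, Tendsto (fun j => l (W j)) atTop (𝓝 (l w))) (z : L2 a b) :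
    Tendsto (fun k => ∫ x in Ioo a b,
        diffuse a₁ b₁ (ε k) (fun _ => s) (fun _ => t) x * z x * (W k).grad x) atTop
      (𝓝 (∫ x in Ioo a b, sharp a a₁ b₁ b (fun _ => s) (fun _ => t) x * z x * w.grad x)) := by
  let Z : ℕ → L2 a b := fun k => (memLp_diffuse_mul (ε := ε k) h s t z).toLp _
  let Z₀ : L2 a b := (memLp_sharp_mul (a₁ := a₁) (b₁ := b₁) s t z).toLp _
  have hZae : ∀ k, Z k =ᵐ[volume.restrict (Ioo a b)]
      fun x => diffuse a₁ b₁ (ε k) (fun _ => s) (fun _ => t) x * z x := fun k =>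
    MemLp.coeFn_toLp _
  have hZ₀ae : Z₀ =ᵐ[volume.restrict (Ioo a b)]
      fun x => sharp a a₁ b₁ b (fun _ => s) (fun _ => t) x * z x := MemLp.coeFn_toLp _
  have hconv : Tendsto Z atTop (𝓝 Z₀) := by
    refine L2.tendsto_of_dominated ((Lp.memLp z).norm.const_mul (|s| + |t|)) ?_ ?_
    · intro k
      filter_upwards [hZae k] with x hx
      rw [hx, abs_mul]
      exact mul_le_mul_of_nonneg_right (abs_diffuse_le _ _ x) (abs_nonneg _)
    · filter_upwards [ae_all_iff.2 hZae, hZ₀ae,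
        ae_tendsto_diffuse h (fun _ => s) (fun _ => t) hε hlim] with x h1 h2 h3
      simp only [h1, h2]
      exact h3.mul_const _
  have e : ∀ k, ∫ x in Ioo a b,
      diffuse a₁ b₁ (ε k) (fun _ => s) (fun _ => t) x * z x * (W k).grad x
        = inner ℝ (Z k - Z₀) (W k).grad + inner ℝ Z₀ (W k).grad := by
    intro k
    rw [inner_sub_left, sub_add_cancel, L2.inner_eq_integral]
    exact integral_congr_ae ((hZae k).mono fun x hx => by simp only [hx])
  have e₀ : ∫ x in Ioo a b, sharp a a₁ b₁ b (fun _ => s) (fun _ => t) x * z x * w.grad x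
      = 0 + inner ℝ Z₀ w.grad := by
    rw [zero_add, L2.inner_eq_integral]
    exact integral_congr_ae (hZ₀ae.mono fun x hx => by simp only [hx])
  simp only [e, e₀]
  refine Tendsto.add ?_ (hW ((innerSL ℝ Z₀).comp H1.gradL))
  have hn := (tendsto_iff_norm_sub_tendsto_zero.1 hconv).mul_const B
  rw [zero_mul] at hn
  refine squeeze_zero_norm (fun k => ?_) hn
  exact (norm_inner_le_norm _ _).trans
    (mul_le_mul_of_nonneg_left ((W k).norm_grad_le.trans (hB k)) (norm_nonneg _))

theorem tendsto_integral_diffuse_mul_sq (hab : a < b) (h : a₁ < b₁)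
    (s t : ℝ) {ε : ℕ → ℝ} (hε : ∀ k, 0 < ε k) (hlim : Tendsto ε atTop (𝓝 0))
    {W : ℕ → H1 a b} {w : H1 a b} {B : ℝ} (hB : ∀ j, ‖W j‖ ≤ B)
    (hW : ∀ l : H1 a b →L[ℝ] ℝ, Tendsto (fun j => l (W j)) atTop (𝓝 (l w))) :
    Tendsto (fun k => ∫ x in Ioo a b,
        diffuse a₁ b₁ (ε k) (fun _ => s) (fun _ => t) x * (W k).toL2 x * (W k).toL2 x) atTop
      (𝓝 (∫ x in Ioo a b,
        sharp a a₁ b₁ b (fun _ => s) (fun _ => t) x * w.toL2 x * w.toL2 x)) := by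
  refine tendsto_integral_of_dominated_convergence
    (fun _ => (|s| + |t|) * (embeddingConst a b * B) * (embeddingConst a b * B))
    (fun k => (integrable_diffuse_mul_mul h s t _ _).aestronglyMeasurable)
    (integrable_const _) (fun k => ?_) ?_
  · filter_upwards [H1.ae_abs_toL2_le_of_norm_le hab (hB k)] with x hx
    rw [Real.norm_eq_abs, abs_mul, abs_mul]
    have := abs_diffuse_le (a₁ := a₁) (b₁ := b₁) (ε := ε k) (fun _ => s) (fun _ => t) x
    have := (abs_nonneg ((W k).toL2 x)).trans hx
    gcongr
  · filter_upwards [ae_tendsto_diffuse h (fun _ => s) (fun _ => t) hε hlim,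
      H1.ae_tendsto_of_weak hab hW] with x h1 h2
    exact (h1.mul h2).mul h2

/-- The loads are only in `L²`, but the uniform bound on the sequence makes a multiple of `|s| +
|t|` an integrable majorant. -/
theorem tendsto_integral_diffuse_mul (hab : a < b) (h : a₁ < b₁)
    (s t : L2 a b) {ε : ℕ → ℝ} (hε : ∀ k, 0 < ε k) (hlim : Tendsto ε atTop (𝓝 0))
    {W : ℕ → H1 a b} {w : H1 a b} {B : ℝ} (hB : ∀ j, ‖W j‖ ≤ B)
    (hW : ∀ l : H1 a b →L[ℝ] ℝ, Tendsto (fun j => l (W j)) atTop (𝓝 (l w))) :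
    Tendsto (fun k => ∫ x in Ioo a b, diffuse a₁ b₁ (ε k) s t x * (W k).toL2 x) atTop
      (𝓝 (∫ x in Ioo a b, sharp a a₁ b₁ b s t x * w.toL2 x)) := by
  refine tendsto_integral_of_dominated_convergence
    (fun x => (|s x| + |t x|) * (embeddingConst a b * B))
    (fun k => ((memLp_diffuse h s t).integrable_mul (q := 2)
      (Lp.memLp (W k).toL2)).aestronglyMeasurable)
    ((s.integrable.abs.add t.integrable.abs).mul_const _) (fun k => ?_) ?_
  · filter_upwards [H1.ae_abs_toL2_le_of_norm_le hab (hB k)] with x hx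
    rw [Real.norm_eq_abs, abs_mul]
    have := abs_diffuse_le (a₁ := a₁) (b₁ := b₁) (ε := ε k) s t x
    gcongr
  · filter_upwards [ae_tendsto_diffuse h s t hε hlim,
      H1.ae_tendsto_of_weak hab hW] with x h1 h2
    exact h1.mul h2

theorem integrable_diffuse_mul (h : a₁ < b₁) (s t u : L2 a b) :
    Integrable (fun x => diffuse a₁ b₁ ε s t x * u x) (volume.restrict (Ioo a b)) :=
  (memLp_diffuse h s t).integrable_mul (q := 2) (Lp.memLp u)

theorem integrable_sharp_mul (s t u : L2 a b) :
    Integrable (fun x => sharp a a₁ b₁ b s t x * u x) (volume.restrict (Ioo a b)) :=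
  (memLp_sharp s t).integrable_mul (q := 2) (Lp.memLp u)

/-! ### Concentration of the boundary term -/

theorem measurable_indicator_of_continuousOn {V : ℝ → ℝ} {S : Set ℝ} (hS : MeasurableSet S)
    (hV : ContinuousOn V S) : Measurable (S.indicator V) := by
  classical
  rw [← piecewise_eq_indicator]
  exact hV.measurable_piecewise continuousOn_const hS

/-- Cutting at the midpoint isolates one kernel on each side. Extension by zero moves both integrals
to the whole line, where they can be rescaled. -/
theorem integral_mul_abs_deriv_phaseField (haa₁ : a < a₁) (h : a₁ < b₁) (hb₁b : b₁ < b)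
    (hε : 0 < ε) {V : ℝ → ℝ} {C : ℝ} (hV : ContinuousOn V (Ioo a b))
    (hC : ∀ x ∈ Ioo a b, |V x| ≤ C) :
    ∫ x in Ioo a b, V x * |deriv (phaseField a₁ b₁ ε) x| =
      (∫ x, (Ioo a ((a₁ + b₁) / 2)).indicator V x * (ε⁻¹ * sechKernel ((x - a₁) / ε))) +
      ∫ x, (Ioo ((a₁ + b₁) / 2) b).indicator V x * (ε⁻¹ * sechKernel ((x - b₁) / ε)) := by
  set m := (a₁ + b₁) / 2 with hm
  have hint : ∀ (S : Set ℝ) (c : ℝ), MeasurableSet S → S ⊆ Ioo a b →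
      Integrable fun x => S.indicator V x * (ε⁻¹ * sechKernel ((x - c) / ε)) := by
    intro S c hS hsub
    refine (integrable_sechKernel_rescale c hε).bdd_mul (c := |C|)
      (measurable_indicator_of_continuousOn hS (hV.mono hsub)).aestronglyMeasurable
      (ae_of_all _ fun x => ?_)
    by_cases hx : x ∈ S
    · rw [indicator_of_mem hx]
      exact (hC x (hsub hx)).trans (le_abs_self C)
    · simp [indicator_of_notMem hx]
  rw [← integral_add (hint _ _ measurableSet_Ioo (Ioo_subset_Ioo_right (by linarith)))
    (hint _ _ measurableSet_Ioo (Ioo_subset_Ioo_left (by linarith))),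
    ← integral_indicator measurableSet_Ioo]
  refine integral_congr_ae ?_
  filter_upwards [Measure.ae_ne volume m] with x hx
  rcases lt_or_gt_of_ne hx with h1 | h1
  · have h2 : x ∉ Ioo m b := fun h2 => lt_asymm h1 h2.1
    rw [indicator_of_notMem h2, zero_mul, add_zero]
    by_cases h3 : a < x
    · rw [indicator_of_mem (show x ∈ Ioo a b from ⟨h3, by linarith⟩),
        indicator_of_mem (show x ∈ Ioo a m from ⟨h3, h1⟩), abs_deriv_phaseField_left h hε h1]
    · rw [indicator_of_notMem fun h4 => h3 h4.1, indicator_of_notMem fun h4 => h3 h4.1, zero_mul]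
  · have h2 : x ∉ Ioo a m := fun h2 => lt_asymm h1 h2.2
    rw [indicator_of_notMem h2, zero_mul, zero_add]
    by_cases h3 : x < b
    · rw [indicator_of_mem (show x ∈ Ioo a b from ⟨by linarith, h3⟩),
        indicator_of_mem (show x ∈ Ioo m b from ⟨h1, h3⟩), abs_deriv_phaseField_right h hε h1]
    · rw [indicator_of_notMem fun h4 => h3 h4.2, indicator_of_notMem fun h4 => h3 h4.2, zero_mul]

/-- Continuously convergent, uniformly bounded functions, integrated against the
modulus of the derivative of `φ_ε`, converge
to the sum of the boundary values of the limit. -/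
theorem tendsto_integral_mul_abs_deriv_phaseField (haa₁ : a < a₁) (h : a₁ < b₁) (hb₁b : b₁ < b)
    {ε : ℕ → ℝ} (hε : ∀ k, 0 < ε k) (hlim : Tendsto ε atTop (𝓝 0)) {V : ℕ → ℝ → ℝ} {V₀ : ℝ → ℝ}
    {C : ℝ} (hV : ∀ k, ContinuousOn (V k) (Ioo a b)) (hC : ∀ k, ∀ x ∈ Ioo a b, |V k x| ≤ C)
    (hconv : ∀ c ∈ Ioo a b, ∀ x : ℕ → ℝ, Tendsto x atTop (𝓝 c) →
      Tendsto (fun k => V k (x k)) atTop (𝓝 (V₀ c))) :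
    Tendsto (fun k => ∫ x in Ioo a b, V k x * |deriv (phaseField a₁ b₁ (ε k)) x|) atTop
      (𝓝 (V₀ a₁ + V₀ b₁)) := by
  have key : ∀ (l r c : ℝ), Ioo l r ⊆ Ioo a b → c ∈ Ioo l r →
      Tendsto (fun k => ∫ x, (Ioo l r).indicator (V k) x *
        ((ε k)⁻¹ * sechKernel ((x - c) / ε k))) atTop (𝓝 (V₀ c)) := by
    intro l r c hsub hc
    refine tendsto_integral_mul_sechKernel hε (C := |C|) (fun k =>
      measurable_indicator_of_continuousOn measurableSet_Ioo ((hV k).mono hsub)) ?_ ?_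
    · intro k x
      by_cases hx : x ∈ Ioo l r
      · rw [indicator_of_mem hx]
        exact (hC k x (hsub hx)).trans (le_abs_self C)
      · simp [indicator_of_notMem hx]
    · intro y
      -- Rescaling evaluates `V k` at moving points `c + ε k * y`, which is why continuous
      -- convergence is assumed. The indicator is eventually `1` there because `c` is interior.
      have hx : Tendsto (fun k => c + ε k * y) atTop (𝓝 c) := by
        simpa using (hlim.mul_const y).const_add c
      refine (hconv c (hsub hc) _ hx).congr' ?_
      filter_upwards [hx.eventually (isOpen_Ioo.mem_nhds hc)] with k hk
      rw [indicator_of_mem (show c + ε k * y ∈ Ioo l r from hk)]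
  simp only [fun k => integral_mul_abs_deriv_phaseField haa₁ h hb₁b (hε k) (hV k) (hC k)]
  exact (key a _ a₁ (Ioo_subset_Ioo_right (by linarith)) ⟨haa₁, by linarith⟩).add
    (key _ b b₁ (Ioo_subset_Ioo_left (by linarith)) ⟨by linarith, hb₁b⟩)

/-- The Hölder estimate is uniform over the bounded sequence; this equicontinuity upgrades
convergence at `c` to convergence along points tending to `c`. -/
theorem H1.tendsto_pointValue_of_tendsto (hab : a < b) {W : ℕ → H1 a b} {w : H1 a b} {B : ℝ}
    (hB : ∀ j, ‖W j‖ ≤ B)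
    (hW : ∀ l : H1 a b →L[ℝ] ℝ, Tendsto (fun j => l (W j)) atTop (𝓝 (l w)))
    {c : ℝ} (hc : c ∈ Ioo a b) {x : ℕ → ℝ} (hx : Tendsto x atTop (𝓝 c)) :
    Tendsto (fun j => pointValue (W j).toL2 (x j)) atTop (𝓝 (pointValue w.toL2 c)) := by
  have h1 : Tendsto (fun j => pointValue (W j).toL2 (x j) - pointValue (W j).toL2 c) atTop
      (𝓝 0) := by
    have h2 : Tendsto (fun j => √|x j - c| * B) atTop (𝓝 0) := by
      simpa using ((hx.sub_const c).abs.sqrt).mul_const B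
    refine squeeze_zero_norm' ?_ h2
    filter_upwards [hx.eventually (isOpen_Ioo.mem_nhds hc)] with j hj
    exact ((W j).abs_pointValue_sub_le hab hc hj).trans
      (mul_le_mul_of_nonneg_left (hB j) (Real.sqrt_nonneg _))
  simpa using h1.add (H1.tendsto_pointValue hab hW hc)

theorem tendsto_boundaryTerm (haa₁ : a < a₁) (h : a₁ < b₁) (hb₁b : b₁ < b) (g : H1 a b)
    {ε : ℕ → ℝ} (hε : ∀ k, 0 < ε k) (hlim : Tendsto ε atTop (𝓝 0))
    {W : ℕ → H1 a b} {w : H1 a b} {B : ℝ} (hB : ∀ j, ‖W j‖ ≤ B)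
    (hW : ∀ l : H1 a b →L[ℝ] ℝ, Tendsto (fun j => l (W j)) atTop (𝓝 (l w))) :
    Tendsto (fun k => ∫ x in Ioo a b,
        (1 / 2 * κ * (W k).toL2 x ^ 2 + g.toL2 x * (W k).toL2 x) *
          |deriv (phaseField a₁ b₁ (ε k)) x|) atTop
      (𝓝 ((1 / 2 * κ * pointValue w.toL2 a₁ ^ 2 + pointValue g.toL2 a₁ * pointValue w.toL2 a₁)
        + (1 / 2 * κ * pointValue w.toL2 b₁ ^ 2
          + pointValue g.toL2 b₁ * pointValue w.toL2 b₁))) := by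
  have hab : a < b := by linarith
  have e : ∀ k, ∫ x in Ioo a b, (1 / 2 * κ * (W k).toL2 x ^ 2 + g.toL2 x * (W k).toL2 x) *
        |deriv (phaseField a₁ b₁ (ε k)) x|
      = ∫ x in Ioo a b, (1 / 2 * κ * pointValue (W k).toL2 x ^ 2
        + pointValue g.toL2 x * pointValue (W k).toL2 x) *
        |deriv (phaseField a₁ b₁ (ε k)) x| := by
    intro k
    refine integral_congr_ae ?_
    filter_upwards [(W k).ae_eq_pointValue hab, g.ae_eq_pointValue hab] with x h1 h2
    rw [h1, h2]
  simp only [e]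
  refine tendsto_integral_mul_abs_deriv_phaseField haa₁ h hb₁b hε hlim
    (V₀ := fun c => 1 / 2 * κ * pointValue w.toL2 c ^ 2
      + pointValue g.toL2 c * pointValue w.toL2 c)
    (C := |1 / 2 * κ| * (embeddingConst a b * B) ^ 2
      + (embeddingConst a b * ‖g‖) * (embeddingConst a b * B)) (fun k => ?_) (fun k x hx => ?_) ?_
  · exact (continuousOn_const.mul (((W k).continuousOn_pointValue hab).pow 2)).add
      ((g.continuousOn_pointValue hab).mul ((W k).continuousOn_pointValue hab))
  · have h1 := ((W k).abs_pointValue_le hab hx).trans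
      (mul_le_mul_of_nonneg_left (hB k) embeddingConst_nonneg)
    have h2 := g.abs_pointValue_le hab hx
    have h3 := (abs_nonneg _).trans h2
    refine (abs_add_le _ _).trans ?_
    rw [abs_mul, abs_mul (pointValue g.toL2 x), abs_pow]
    gcongr
  · intro c hc x hx
    have h1 := H1.tendsto_pointValue_of_tendsto hab hB hW hc hx
    have h2 := ((g.continuousOn_pointValue hab).continuousAt (isOpen_Ioo.mem_nhds hc)).tendsto.comp
      hx
    exact ((h1.pow 2).const_mul _).add (h2.mul h1)

/-! ### Compactness and Γ-convergence -/

/-- The diffuse energy of `u`, with the square of the gradient replaced by its tangent at the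
gradient of `w`. -/
def tangentEnergy (a₁ b₁ α β γ κ : ℝ) (h q : L2 a b) (g : H1 a b) (ε : ℝ) (w u : H1 a b) : ℝ :=
  ∫ x in Ioo a b,
    (1 / 2 * (diffuse a₁ b₁ ε (fun _ => α) (fun _ => 1) x *
          (2 * u.grad x * w.grad x - w.grad x ^ 2)
        + diffuse a₁ b₁ ε (fun _ => β) (fun _ => γ) x * u.toL2 x ^ 2)
      - diffuse a₁ b₁ ε h q x * u.toL2 x
      + (1 / 2 * κ * u.toL2 x ^ 2 + g.toL2 x * u.toL2 x) * |deriv (phaseField a₁ b₁ ε) x|)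

theorem tangentEnergy_self (h q : L2 a b) (g u : H1 a b) :
    tangentEnergy a₁ b₁ α β γ κ h q g ε u u = diffuseEnergy a₁ b₁ α β γ κ h q g ε u := by
  unfold tangentEnergy diffuseEnergy
  congr 1
  ext x
  ring

theorem integrable_tangentEnergy_integrand (hab : a < b) (h₁ : a₁ < b₁) (hε : 0 < ε)
    (h q : L2 a b) (g w u : H1 a b) :
    Integrable (fun x =>
      (1 / 2 * (diffuse a₁ b₁ ε (fun _ => α) (fun _ => 1) x *
          (2 * u.grad x * w.grad x - w.grad x ^ 2)
        + diffuse a₁ b₁ ε (fun _ => β) (fun _ => γ) x * u.toL2 x ^ 2)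
      - diffuse a₁ b₁ ε h q x * u.toL2 x
      + (1 / 2 * κ * u.toL2 x ^ 2 + g.toL2 x * u.toL2 x) * |deriv (phaseField a₁ b₁ ε) x|))
      (volume.restrict (Ioo a b)) := by
  have i1 := integrable_diffuse_mul_mul (ε := ε) h₁ α 1 u.grad w.grad
  have i2 := (integrable_diffuse_mul_mul (ε := ε) h₁ α 1 w.grad w.grad).const_mul (1 / 2)
  have i3 := (integrable_diffuse_mul_mul (ε := ε) h₁ β γ u.toL2 u.toL2).const_mul (1 / 2)
  have i4 := integrable_diffuse_mul (ε := ε) h₁ h q u.toL2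
  have i5 := integrable_boundaryTerm (κ := κ) hab h₁ hε g u
  refine ((((i1.sub i2).add i3).sub i4).add i5).congr (ae_of_all _ fun x => ?_)
  simp only [Pi.add_apply, Pi.sub_apply]
  ring

theorem integrable_diffuseEnergy_integrand (hab : a < b) (h₁ : a₁ < b₁) (hε : 0 < ε)
    (h q : L2 a b) (g u : H1 a b) :
    Integrable (fun x =>
      (1 / 2 * (diffuse a₁ b₁ ε (fun _ => α) (fun _ => 1) x * u.grad x ^ 2
        + diffuse a₁ b₁ ε (fun _ => β) (fun _ => γ) x * u.toL2 x ^ 2)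
      - diffuse a₁ b₁ ε h q x * u.toL2 x
      + (1 / 2 * κ * u.toL2 x ^ 2 + g.toL2 x * u.toL2 x) * |deriv (phaseField a₁ b₁ ε) x|))
      (volume.restrict (Ioo a b)) := by
  refine (integrable_tangentEnergy_integrand (α := α) (β := β) (γ := γ) (κ := κ) hab h₁ hε h q g
    u u).congr (ae_of_all _ fun x => ?_)
  ring

/-- The integrands differ by `½ D_ε (u' - w')²`, and `D_ε ≥ 0`. -/
theorem tangentEnergy_le (hα : 0 < α) (hab : a < b) (h₁ : a₁ < b₁) (hε : 0 < ε)
    (h q : L2 a b) (g w u : H1 a b) :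
    tangentEnergy a₁ b₁ α β γ κ h q g ε w u ≤ diffuseEnergy a₁ b₁ α β γ κ h q g ε u := by
  refine integral_mono (integrable_tangentEnergy_integrand hab h₁ hε h q g w u)
    (integrable_diffuseEnergy_integrand hab h₁ hε h q g u) fun x => ?_
  have hD : 0 ≤ diffuse a₁ b₁ ε (fun _ => α) (fun _ => 1) x :=
    le_diffuse_const hα.le zero_le_one x
  simp only
  nlinarith [mul_nonneg hD (sq_nonneg (u.grad x - w.grad x))]

/-- The common core of both Γ-inequalities. The tangent is taken at the weak limit itself, so in the
limit `2u'w' - |w'|²` becomes `|w'|²` and the sharp energy appears. -/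
theorem tendsto_tangentEnergy (haa₁ : a < a₁) (h₁ : a₁ < b₁) (hb₁b : b₁ < b)
    (h q : L2 a b) (g : H1 a b)
    {ε : ℕ → ℝ} (hε : ∀ k, 0 < ε k) (hlim : Tendsto ε atTop (𝓝 0))
    {W : ℕ → H1 a b} {w : H1 a b} {B : ℝ} (hB : ∀ j, ‖W j‖ ≤ B)
    (hW : ∀ l : H1 a b →L[ℝ] ℝ, Tendsto (fun j => l (W j)) atTop (𝓝 (l w))) :
    Tendsto (fun k => tangentEnergy a₁ b₁ α β γ κ h q g (ε k) w (W k)) atTop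
      (𝓝 (sharpEnergy a₁ b₁ α β γ κ h q g w)) := by
  have hab : a < b := by linarith
  have t1 := tendsto_integral_diffuse_mul_grad h₁ α 1 hε hlim hB hW w.grad
  -- The correction `½ D_ε |w'|²` is the same pairing along the constant sequence `w`.
  have t2 := tendsto_integral_diffuse_mul_grad h₁ α 1 hε hlim
    (W := fun _ => w) (fun _ => le_rfl) (fun l => tendsto_const_nhds) w.grad
  have t3 := tendsto_integral_diffuse_mul_sq hab h₁ β γ hε hlim hB hW
  have t4 := tendsto_integral_diffuse_mul hab h₁ h q hε hlim hB hW
  have t5 := tendsto_boundaryTerm (κ := κ) haa₁ h₁ hb₁b g hε hlim hB hW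
  have T := (((t1.sub (t2.const_mul (1 / 2))).add (t3.const_mul (1 / 2))).sub t4).add t5
  refine (T.congr fun k => ?_).trans (le_of_eq (congrArg 𝓝 ?_))
  · have i1 := integrable_diffuse_mul_mul (ε := ε k) h₁ α 1 (W k).grad w.grad
    have i2 := (integrable_diffuse_mul_mul (ε := ε k) h₁ α 1 w.grad w.grad).const_mul (1 / 2)
    have i3 := (integrable_diffuse_mul_mul (ε := ε k) h₁ β γ (W k).toL2 (W k).toL2).const_mul
      (1 / 2)
    have i4 := integrable_diffuse_mul (ε := ε k) h₁ h q (W k).toL2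
    have i5 := integrable_boundaryTerm (κ := κ) hab h₁ (hε k) g (W k)
    rw [← integral_const_mul, ← integral_const_mul, ← integral_sub' i1 i2,
      ← integral_add' (i1.sub i2) i3, ← integral_sub' ((i1.sub i2).add i3) i4,
      ← integral_add' (((i1.sub i2).add i3).sub i4) i5, tangentEnergy]
    refine integral_congr_ae (ae_of_all _ fun x => ?_)
    simp only [Pi.add_apply, Pi.sub_apply]
    ring
  · have i1 := integrable_sharp_mul_mul (a₁ := a₁) (b₁ := b₁) α 1 w.grad w.grad
    have i2 := i1.const_mul (1 / 2)
    have i3 := (integrable_sharp_mul_mul (a₁ := a₁) (b₁ := b₁) β γ w.toL2 w.toL2).const_mul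
      (1 / 2)
    have i4 := integrable_sharp_mul (a₁ := a₁) (b₁ := b₁) h q w.toL2
    rw [← integral_const_mul, ← integral_const_mul, ← integral_sub' i1 i2,
      ← integral_add' (i1.sub i2) i3, ← integral_sub' ((i1.sub i2).add i3) i4, sharpEnergy,
      ← add_assoc]
    congr 2
    refine integral_congr_ae (ae_of_all _ fun x => ?_)
    simp only [Pi.add_apply, Pi.sub_apply]
    ring

/-- Coercivity of the diffuse energies, uniformly in `ε`. -/
theorem exists_le_diffuseEnergy (hab : a < b) (h₁ : a₁ < b₁) (hα : 0 < α) (hβ : 0 < β)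
    (hγ : 0 < γ) (hκ : 0 ≤ κ) (h q : L2 a b) (g : H1 a b) :
    ∃ m K : ℝ, 0 < m ∧ 0 ≤ K ∧ ∀ ε, 0 < ε → ∀ u : H1 a b,
      m * ‖u‖ ^ 2 - K * ‖u‖ ≤ diffuseEnergy a₁ b₁ α β γ κ h q g ε u := by
  obtain ⟨m, hm, hmα, hm1, hmβ, hmγ⟩ : ∃ m : ℝ, 0 < m ∧ m ≤ α ∧ m ≤ 1 ∧ m ≤ β ∧ m ≤ γ :=
    ⟨min (min α 1) (min β γ), by positivity, by simp, by simp, by simp, by simp⟩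
  set C := embeddingConst a b
  have hC : 0 ≤ C := embeddingConst_nonneg
  have hI : 0 ≤ ∫ x in Ioo a b, (|h x| + |q x|) := integral_nonneg fun x => by positivity
  -- In the linear constant, the first summand bounds the bulk load through `|u| ≤ C ‖u‖`. The
  -- second bounds `g u` by `C ‖g‖ * (C ‖u‖)`, and its factor `2` is the mass bound for `|φ_ε'|`.
  refine ⟨1 / 2 * m, C * (∫ x in Ioo a b, (|h x| + |q x|)) + C * ‖g‖ * C * 2, by positivity,
    by positivity, fun ε hε u => ?_⟩
  have i1 := ((L2.integrable_sq u.grad).add (L2.integrable_sq u.toL2)).const_mul (1 / 2 * m)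
  have i2 := (h.integrable.abs.add q.integrable.abs).mul_const (C * ‖u‖)
  have i3 := ((integrable_abs_deriv_phaseField h₁ hε).restrict (s := Ioo a b)).const_mul
    (C * ‖g‖ * (C * ‖u‖))
  have hle := integral_mono_ae ((i1.sub i2).sub i3)
    (integrable_diffuseEnergy_integrand (α := α) (β := β) (γ := γ) (κ := κ) hab h₁ hε h q g u) (by
      filter_upwards [u.ae_abs_toL2_le hab, g.ae_abs_toL2_le hab] with x hu hg
      have d1 := mul_le_mul_of_nonneg_right
        (le_diffuse_const (a₁ := a₁) (b₁ := b₁) (ε := ε) hmα hm1 x) (sq_nonneg (u.grad x))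
      have d2 := mul_le_mul_of_nonneg_right
        (le_diffuse_const (a₁ := a₁) (b₁ := b₁) (ε := ε) hmβ hmγ x) (sq_nonneg (u.toL2 x))
      have d3 : diffuse a₁ b₁ ε h q x * u.toL2 x ≤ (|h x| + |q x|) * (C * ‖u‖) := by
        refine (le_abs_self _).trans ?_
        rw [abs_mul]
        exact mul_le_mul (abs_diffuse_le _ _ x) hu (abs_nonneg _) (by positivity)
      have d4 : -(C * ‖g‖ * (C * ‖u‖)) ≤ 1 / 2 * κ * u.toL2 x ^ 2 + g.toL2 x * u.toL2 x := by
        have e1 : |g.toL2 x * u.toL2 x| ≤ C * ‖g‖ * (C * ‖u‖) := by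
          rw [abs_mul]
          exact mul_le_mul hg hu (abs_nonneg _) (by positivity)
        have e2 : 0 ≤ 1 / 2 * κ * u.toL2 x ^ 2 := by positivity
        linarith [neg_abs_le (g.toL2 x * u.toL2 x)]
      have d5 := mul_le_mul_of_nonneg_right d4 (abs_nonneg (deriv (phaseField a₁ b₁ ε) x))
      simp only [Pi.add_apply, Pi.sub_apply]
      linarith)
  refine le_trans ?_ hle
  rw [integral_sub' (i1.sub i2) i3, integral_sub' i1 i2, integral_const_mul, integral_mul_const,
    integral_const_mul, integral_add' (L2.integrable_sq u.grad) (L2.integrable_sq u.toL2),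
    ← L2.norm_sq_eq_integral, ← L2.norm_sq_eq_integral, u.norm_sq_eq]
  simp only [Pi.add_apply]
  have hk : C * ‖g‖ * (C * ‖u‖) * ∫ x in Ioo a b, |deriv (phaseField a₁ b₁ ε) x| ≤
      C * ‖g‖ * (C * ‖u‖) * 2 :=
    mul_le_mul_of_nonneg_left (integral_abs_deriv_phaseField_le h₁ hε) (by positivity)
  linarith

theorem exists_norm_le_of_diffuseEnergy_lt (hab : a < b) (h₁ : a₁ < b₁) (hα : 0 < α) (hβ : 0 < β)
    (hγ : 0 < γ) (hκ : 0 ≤ κ) (h q : L2 a b) (g : H1 a b) (M : ℝ) :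
    ∃ B : ℝ, ∀ ε, 0 < ε → ∀ u : H1 a b,
      diffuseEnergy a₁ b₁ α β γ κ h q g ε u < M → ‖u‖ ≤ B := by
  obtain ⟨m, K, hm, hK, hE⟩ := exists_le_diffuseEnergy (a₁ := a₁) (b₁ := b₁) hab h₁ hα hβ hγ hκ
    h q g
  -- Beyond this radius `m ‖u‖ - K > |M|`; the `+ 1` ensures `‖u‖ ≥ 1`, so multiplying by `‖u‖`
  -- keeps the lower bound above `|M|`.
  refine ⟨(K + |M|) / m + 1, fun ε hε u hu => ?_⟩
  by_contra! hlt
  have h1 := (hE ε hε u).trans_lt hu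
  have h2 : 1 ≤ ‖u‖ := by
    have : 0 ≤ (K + |M|) / m := by positivity
    linarith
  have h3 : K + |M| < m * ‖u‖ := by
    rw [← div_lt_iff₀' hm]
    linarith
  nlinarith [le_abs_self M, abs_nonneg M]

theorem energyCompact_diffuseEnergy (hab : a < b) (h₁ : a₁ < b₁) (hα : 0 < α) (hβ : 0 < β)
    (hγ : 0 < γ) (hκ : 0 ≤ κ) (h q : L2 a b) (g : H1 a b) :
    EnergyCompact (fun ε => extendTop (diffuseEnergy a₁ b₁ α β γ κ h q g ε)) := by
  intro ε hε _ U M hU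
  choose V hV using fun k => exists_toL2_eq_of_extendTop_lt_top ((hU k).trans (EReal.coe_lt_top M))
  obtain ⟨B, hB⟩ := exists_norm_le_of_diffuseEnergy_lt (a₁ := a₁) (b₁ := b₁) hab h₁ hα hβ hγ hκ
    h q g M
  have hVB : ∀ k, ‖V k‖ ≤ B := fun k => hB (ε k) (hε k).1 (V k) (by
    have := hU k
    rw [← hV k] at this
    simp only [extendTop_toL2] at this
    exact EReal.coe_lt_coe_iff.1 this)
  obtain ⟨w, σ, hσ, hw⟩ := exists_weakly_convergent_subseq hVB
  refine ⟨σ, fun j => V (σ j), w, hσ, fun j => hV _, ?_, hw, ?_⟩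
  · simp only [← hV]
    exact H1.tendsto_toL2_of_weak hab (fun j => hVB (σ j)) hw
  · simp only [← hV]
    exact H1.ae_tendsto_of_weak hab hw

theorem gammaConverges_diffuseEnergy (haa₁ : a < a₁) (h₁ : a₁ < b₁) (hb₁b : b₁ < b)
    (hα : 0 < α) (hβ : 0 < β) (hγ : 0 < γ) (hκ : 0 ≤ κ) (h q : L2 a b) (g : H1 a b) :
    GammaConverges (fun ε => extendTop (diffuseEnergy a₁ b₁ α β γ κ h q g ε))
      (extendTop (sharpEnergy a₁ b₁ α β γ κ h q g)) := by
  have hab : a < b := by linarith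
  intro ε hε hlim
  refine ⟨fun u U hU => ?_, fun u => ⟨fun _ => u, tendsto_const_nhds, ?_⟩⟩
  · by_contra! hlt
    -- A real level `c` strictly between the two sides gives a subsequence with all energies below
    -- `c`, hence in `H¹` and precompact; infinite values need no separate treatment.
    obtain ⟨c, hc1, hc2⟩ := EReal.lt_iff_exists_real_btwn.1 hlt
    obtain ⟨τ, hτ, hτc⟩ := extraction_of_frequently_atTop
      (frequently_lt_of_liminf_lt (by isBoundedDefault) hc1)
    have hlimτ := hlim.comp hτ.tendsto_atTop
    obtain ⟨σ, W, w, hσ, hWU, hconv, hweak, -⟩ := energyCompact_diffuseEnergy hab h₁ hα hβ hγ hκ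
      h q g (ε ∘ τ) (fun k => hε _) hlimτ (U ∘ τ) c hτc
    -- Uniqueness of strong `L²` limits identifies `u` with the weak limit; in particular, this
    -- rules out `u` outside `H¹`.
    obtain rfl : u = w.toL2 := tendsto_nhds_unique
      ((hU.comp hτ.tendsto_atTop).comp hσ.tendsto_atTop) hconv
    have hE : ∀ j, diffuseEnergy a₁ b₁ α β γ κ h q g (ε (τ (σ j))) (W j) < c := fun j => by
      have := hτc (σ j)
      have e : U (τ (σ j)) = (W j).toL2 := (hWU j).symm
      simp only [e, extendTop_toL2] at this
      exact EReal.coe_lt_coe_iff.1 this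
    obtain ⟨B, hB⟩ := exists_norm_le_of_diffuseEnergy_lt (a₁ := a₁) (b₁ := b₁) hab h₁ hα hβ hγ hκ
      h q g c
    have hWB : ∀ j, ‖W j‖ ≤ B := fun j => hB _ (hε _).1 _ (hE j)
    have hT := tendsto_tangentEnergy (α := α) (β := β) (γ := γ) (κ := κ) haa₁ h₁ hb₁b h q g
      (ε := fun j => ε (τ (σ j))) (fun j => (hε _).1) (hlimτ.comp hσ.tendsto_atTop) hWB hweak
    have hle : sharpEnergy a₁ b₁ α β γ κ h q g w ≤ c := le_of_tendsto hT
      (Eventually.of_forall fun j =>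
        (tangentEnergy_le hα hab h₁ (hε _).1 h q g w (W j)).trans (hE j).le)
    rw [extendTop_toL2, EReal.coe_lt_coe_iff] at hc2
    exact absurd hle (not_le.2 hc2)
  · by_cases hu : ∃ w : H1 a b, w.toL2 = u
    · obtain ⟨w, rfl⟩ := hu
      simp only [extendTop_toL2]
      have hT := tendsto_tangentEnergy (α := α) (β := β) (γ := γ) (κ := κ) haa₁ h₁ hb₁b h q g
        (fun k => (hε k).1) hlim (W := fun _ => w) (fun _ => le_rfl) (fun l => tendsto_const_nhds)
      simp only [tangentEnergy_self] at hT
      exact ((continuous_coe_real_ereal.tendsto _).comp hT).limsup_eq.le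
    · rw [extendTop, dif_neg hu]
      exact le_top

end DiffuseDomain

end

theorem mainTheorem3 (a a₁ b₁ b α β γ κ : ℝ)
    (haa₁ : a < a₁) (ha₁b₁ : a₁ < b₁) (hb₁b : b₁ < b)
    (hα : 0 < α) (hβ : 0 < β) (hγ : 0 < γ) (hκ : 0 ≤ κ)
    (h q : DiffuseDomain.L2 a b) (g : DiffuseDomain.H1 a b) :
    DiffuseDomain.EnergyCompact
      (fun ε => DiffuseDomain.extendTop
        (DiffuseDomain.diffuseEnergy a₁ b₁ α β γ κ h q g ε)) ∧
    DiffuseDomain.GammaConverges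
      (fun ε => DiffuseDomain.extendTop
        (DiffuseDomain.diffuseEnergy a₁ b₁ α β γ κ h q g ε))
      (DiffuseDomain.extendTop
        (DiffuseDomain.sharpEnergy a₁ b₁ α β γ κ h q g)) :=
  ⟨DiffuseDomain.energyCompact_diffuseEnergy (haa₁.trans (ha₁b₁.trans hb₁b)) ha₁b₁ hα hβ hγ hκ
      h q g,
    DiffuseDomain.gammaConverges_diffuseEnergy haa₁ ha₁b₁ hb₁b hα hβ hγ hκ h q g⟩
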